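/- Let $\mathbb{B}=\bigcup_{n\ge 0}\{0,1\}^n$ be the full binary tree: the root is the empty word $\varnothing$ and each vertex $u$ is joined by edges to its children $u0$ and $u1$. Given numbers $a=(a_u)$ of cars arriving on the vertices of a finite subtree $\mathbf{t}\ni\varnothing$ of $\mathbb{B}$, each car tries to park on its arrival vertex; if that spot is already taken, it drives towards the root and parks on the first free vertex that it meets, or leaves the tree at the root if there is none. The number $x_{\mathbf{t}}(u)$ of cars that visit a vertex $u$ (including the car that parks there, if any) does not depend on the order in which the cars are parked. For arrivals $(a_u)_{u\in\mathbb{B}}$ on the whole tree let $x(u)=\lim_{n\to\infty}x_{[\mathbb{B}]_n}(u)\in\{0,1,2,\dots\}\cup\{\infty\}$, where $[\mathbb{B}]_n$ is the set of vertices of height at most $n$ (the sequence is non-decreasing). A vertex $u$ is occupied if $x(u)\ge 1$. Let $\mu=(\mu_k)_{k\ge 0}$ be a probability distribution on $\{0,1,2,\dots\}$ with $\mu_0+\mu_1<1$, let $(A_u)_{u\in\mathbb{B}}$ be i.i.d. car arrivals with law $\mu$, and let $X$ be the number of cars that visit $\varnothing$ in the resulting parking process on $\mathbb{B}$. The law $\mu$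 is called subcritical if $\mathbb{E}[X]<\infty$ and, almost surely, all clusters (connected components) of occupied vertices are finite. A fully parked tree is a finite connected set $\mathbf{t}\subset\mathbb{B}$ of vertices containing $\varnothing$, decorated by car arrivals $(a_u)_{u\in\mathbf{t}}$ such that all vertices of $\mathbf{t}$ are occupied after the cars are parked. Its outgoing flux is $x_{\mathbf{t}}(\varnothing)-1$ and its weight is $w(\mathbf{t})=\prod_{u\in\mathbf{t}}\mu_{a_u}$. Let $\mathbb{T}_n^{(p)}$ be the set of fully parked trees with $n$ vertices and outgoing flux $p$, and for $x,y\ge 0$ (with $0^0=1$) let $$F(x,y)=\sum_{n\ge 1}\sum_{p\ge 0}\sum_{\mathbf{t}\in\mathbb{T}_n^{(p)}}x^n y^p\,w(\mathbf{t})\in[0,\infty].$$ **Proposition.** The law $\mu$ is subcritical if and only if there is a real number $x>0$ such that $F(x,0)<\infty$ and $$1=\mu_0\,x\,\bigl(1+F(x,0)\bigr)^2 .$$ -/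

import Mathlib

open MeasureTheory
open scoped ENNReal NNReal

noncomputable section

namespace Parking

/-! ### The full binary tree -/

/-- Vertices of the full binary tree: finite words on two letters, the root being the empty word. -/
abbrev Vertex := List Bool

/-- The full binary tree as a graph: edges join `u` to its two children `u0` and `u1`. -/
def binaryTree : SimpleGraph Vertex :=
  SimpleGraph.fromRel fun u v => ∃ b : Bool, v = u ++ [b]

/-- The finite tree made of the vertices of height at most `n`. -/
def ball (n : ℕ) : Finset Vertex := (List.finite_length_le Bool n).toFinset

/-! ### Parking on finite trees, one car after the other -/

/-- A configuration: the occupied spots, and the number of cars that have visited each vertex. -/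
structure Config where
  occupied : Finset Vertex
  visits : Vertex → ℕ

/-- One car drives from `u` towards the root: it visits `u` and parks there if `u` is free.
Otherwise it goes on to the parent of `u`, or leaves the tree if `u` is the root. -/
def drive (s : Config) (u : Vertex) : Config :=
  if u ∈ s.occupied then
    if _h : u = [] then ⟨s.occupied, Function.update s.visits u (s.visits u + 1)⟩
    else drive ⟨s.occupied, Function.update s.visits u (s.visits u + 1)⟩ u.dropLast
  else ⟨insert u s.occupied, Function.update s.visits u (s.visits u + 1)⟩
termination_by u.length
decreasing_by
  have : 0 < u.length := List.length_pos_iff.mpr _h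
  simp only [List.length_dropLast]
  omega

/-- Park a list of cars, given by their arrival vertices, one after the other, in this order. -/
def park (cars : List Vertex) : Config := cars.foldl drive ⟨∅, fun _ => 0⟩

/-- The cars of the arrivals `a` on the vertices of the finite tree `t`, listed in some order. -/
def carList (t : Finset Vertex) (a : Vertex → ℕ) : List Vertex :=
  t.toList.flatMap fun u => List.replicate (a u) u

/-- The number of cars that visit `u` when the cars arriving on the finite tree `t` are parked.
(Cars only move towards the root, hence stay in `t` when `t` is a subtree that contains the root.)
By `park_visits_perm` it does not depend on the order of the cars. -/
def visits (t : Finset Vertex) (a : Vertex → ℕ) (u : Vertex) : ℕ := (park (carList t a)).visits u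

lemma flux_congr (f : Vertex → ℕ) (w v : Vertex) (x : ℕ)
    (h : ∀ b : Bool, w ++ [b] ≠ v) :
    ∑ b : Bool, (Function.update f v x (w ++ [b]) - 1) = ∑ b : Bool, (f (w ++ [b]) - 1) := by
  refine Finset.sum_congr rfl fun b _ => ?_
  rw [Function.update_of_ne (h b)]

/-- Mass balance is kept by the drive of a car: before, the car is pending at `v`. -/
lemma drive_inv (c : Vertex → ℕ) (s : Config) (v : Vertex)
    (ho : ∀ u, u ∈ s.occupied ↔ 0 < s.visits u)
    (hb : ∀ u, s.visits u + (if u = v then 1 else 0)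
      = c u + ∑ b : Bool, (s.visits (u ++ [b]) - 1)) :
    (∀ u, u ∈ (drive s v).occupied ↔ 0 < (drive s v).visits u) ∧
    (∀ u, (drive s v).visits u = c u + ∑ b : Bool, ((drive s v).visits (u ++ [b]) - 1)) := by
  have hself : ∀ b : Bool, v ++ [b] ≠ v := fun b h => by simpa using congrArg List.length h
  rw [drive]
  split_ifs with h1 h2
  · subst h2
    refine ⟨fun u => ?_, fun u => ?_⟩
    · by_cases hu : u = []
      · subst hu; simp [h1]
      · simp only [Function.update_of_ne hu]; exact ho u
    · dsimp only
      rw [flux_congr _ _ _ _ (fun b => by simp), ← hb u]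
      by_cases hu : u = []
      · subst hu; simp
      · simp [hu]
  · obtain ⟨p, b₀, rfl⟩ : ∃ p b₀, v = p ++ [b₀] :=
      ⟨v.dropLast, v.getLast h2, (List.dropLast_append_getLast h2).symm⟩
    refine drive_inv c _ _ (fun u => ?_) (fun u => ?_)
    · by_cases hu : u = p ++ [b₀]
      · subst hu; simp [h1]
      · simp only [Function.update_of_ne hu]; exact ho u
    · simp only [List.dropLast_concat]
      have hv := (ho _).1 h1
      by_cases hup : u = p
      · subst hup
        have hb' := hb u
        have hne : u ≠ u ++ [b₀] := fun h => by simpa using congrArg List.length h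
        rw [Function.update_of_ne hne]
        rw [if_neg hne] at hb'
        cases b₀ <;> simp at hb' hv ⊢ <;> omega
      · rw [flux_congr _ _ _ _ (fun b h => hup (by simpa using (List.append_inj' h rfl).1)), ← hb u]
        by_cases hu : u = p ++ [b₀]
        · subst hu; simp
        · simp [hu, hup]
  · have hv : s.visits v = 0 := by have := (ho v).not.1 h1; omega
    refine ⟨fun u => ?_, fun u => ?_⟩
    · by_cases hu : u = v
      · subst hu; simp
      · simp only [Function.update_of_ne hu, Finset.mem_insert, hu, false_or]; exact ho u
    · dsimp only
      have : ∑ b : Bool, (Function.update s.visits v (s.visits v + 1) (u ++ [b]) - 1)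
          = ∑ b : Bool, (s.visits (u ++ [b]) - 1) := by
        refine Finset.sum_congr rfl fun b _ => ?_
        by_cases hu : u ++ [b] = v
        · rw [hu]; simp [hv]
        · rw [Function.update_of_ne hu]
      rw [this, ← hb u]
      by_cases hu : u = v
      · subst hu; simp
      · simp [hu]
termination_by v.length
decreasing_by
  rename_i h
  subst h
  simp

lemma drive_far (N : ℕ) (s : Config) (v : Vertex) (hv : v.length ≤ N)
    (hs : ∀ u, N < u.length → s.visits u = 0) :
    ∀ u, N < u.length → (drive s v).visits u = 0 := by
  have key : ∀ u : Vertex, N < u.length →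
      Function.update s.visits v (s.visits v + 1) u = 0 := fun u hu => by
    rw [Function.update_of_ne (by rintro rfl; omega)]; exact hs u hu
  rw [drive]
  split_ifs with h1 h2
  · exact key
  · exact drive_far N _ _ (by simp; omega) key
  · exact key
termination_by v.length
decreasing_by
  have : 0 < v.length := List.length_pos_iff.mpr h2
  simp only [List.length_dropLast]
  omega

lemma park_inv (cars : List Vertex) :
    (∀ u, u ∈ (park cars).occupied ↔ 0 < (park cars).visits u) ∧
    (∀ u, (park cars).visits u
      = cars.count u + ∑ b : Bool, ((park cars).visits (u ++ [b]) - 1)) := by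
  induction cars using List.reverseRecOn with
  | nil => simp [park]
  | append_singleton l v ih =>
    have : park (l ++ [v]) = drive (park l) v := by simp [park]
    rw [this]
    refine drive_inv _ _ _ ih.1 fun u => ?_
    rw [ih.2 u, List.count_append, List.count_singleton]
    simp only [beq_iff_eq, eq_comm (a := v)]
    omega

/-- The cars that visit `u` are those that arrive on `u`, and all the cars that visit a child of
`u` except the one that parks on this child. -/
theorem park_visits_eq (cars : List Vertex) (u : Vertex) :
    (park cars).visits u
      = cars.count u + ∑ b : Bool, ((park cars).visits (u ++ [b]) - 1) :=
  (park_inv cars).2 u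

/-- A spot is occupied after the parking if and only if some car visited it. -/
theorem mem_park_occupied_iff (cars : List Vertex) (u : Vertex) :
    u ∈ (park cars).occupied ↔ 1 ≤ (park cars).visits u :=
  (park_inv cars).1 u

/-- No car visits the vertices above all arrivals. -/
theorem park_visits_far (cars : List Vertex) (N : ℕ) (h : ∀ v ∈ cars, v.length ≤ N) :
    ∀ u, N < u.length → (park cars).visits u = 0 := by
  induction cars using List.reverseRecOn with
  | nil => simp [park]
  | append_singleton l v ih =>
    have : park (l ++ [v]) = drive (park l) v := by simp [park]
    rw [this]
    exact drive_far N _ _ (h v (by simp)) (ih fun w hw => h w (by simp [hw]))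

/-- The number of visits does not depend on the order in which the cars are parked. -/
theorem park_visits_perm {cars cars' : List Vertex} (h : cars.Perm cars') :
    (park cars).visits = (park cars').visits := by
  obtain ⟨N, hN⟩ : ∃ N, ∀ v ∈ cars, v.length ≤ N :=
    ⟨(cars.map List.length).sum, fun v hv =>
      List.le_sum_of_mem (List.mem_map_of_mem hv)⟩
  have hN' : ∀ v ∈ cars', v.length ≤ N := fun v hv => hN v (h.mem_iff.2 hv)
  have key : ∀ k : ℕ, ∀ u : Vertex, N < u.length + k →
      (park cars).visits u = (park cars').visits u := by
    intro k
    induction k with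
    | zero =>
      intro u hu
      rw [park_visits_far cars N hN u hu, park_visits_far cars' N hN' u hu]
    | succ k ih =>
      intro u hu
      rw [park_visits_eq, park_visits_eq cars', h.count_eq]
      congr 1
      refine Finset.sum_congr rfl fun b _ => ?_
      rw [ih (u ++ [b]) (by simp; omega)]
  exact funext fun u => key (N + 1) u (by omega)

/-! ### Parking on the infinite tree -/

/-- The number of cars that visit `u` in the parking process on the full binary tree with car
arrivals `a` (lowest cars first): the limit of the nondecreasing numbers of visits for the parking
on the first `n` generations. -/
def totalVisits (a : Vertex → ℕ) (u : Vertex) : ℕ∞ := ⨆ n : ℕ, (visits (ball n) a u : ℕ∞)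

/-- The black (occupied) vertices. -/
def black (a : Vertex → ℕ) : Set Vertex := {u | 1 ≤ totalVisits a u}

/-- The law of i.i.d. car arrivals with common law `μ` on the vertices of the tree. -/
def arrivalLaw (μ : PMF ℕ) : Measure (Vertex → ℕ) := Measure.infinitePi fun _ => μ.toMeasure

/-- The law `μ` is subcritical: the number of cars that visit the root has a finite mean and,
almost surely, all clusters (connected components) of occupied vertices are finite. -/
def Subcritical (μ : PMF ℕ) : Prop :=
  ∫⁻ a, (totalVisits a [] : ℝ≥0∞) ∂(arrivalLaw μ) < ∞ ∧
  ∀ᵐ a ∂(arrivalLaw μ),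
    ∀ C : (binaryTree.induce (black a)).ConnectedComponent, C.supp.Finite

/-! ### Fully parked trees -/

/-- A fully parked tree: a finite connected set of vertices that contains the root, decorated by
car arrivals on its vertices (encoded as a function that vanishes off the tree), such that every
vertex is occupied after parking. -/
structure FullyParkedTree where
  verts : Finset Vertex
  root_mem : [] ∈ verts
  connected : (binaryTree.induce (verts : Set Vertex)).Connected
  arrivals : Vertex →₀ ℕ
  support_subset : arrivals.support ⊆ verts
  parked : ∀ u ∈ verts, 1 ≤ visits verts arrivals u

/-- The outgoing flux of cars: all the visitors of the root but one. -/
def FullyParkedTree.flux (t : FullyParkedTree) : ℕ := visits t.verts t.arrivals [] - 1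

/-- The weight of a fully parked tree. -/
def FullyParkedTree.weight (μ : PMF ℕ) (t : FullyParkedTree) : ℝ≥0∞ :=
  ∏ u ∈ t.verts, μ (t.arrivals u)

/-- The fully parked trees with `n` vertices and outgoing flux `p` (none if `n = 0`). -/
def fullyParked (n p : ℕ) : Set FullyParkedTree := {t | t.verts.card = n ∧ t.flux = p}

/-- The bivariate generating function of weighted fully parked trees at nonnegative arguments,
with value `∞` where the series of nonnegative terms diverges. -/
def genF (μ : PMF ℕ) (x y : ℝ≥0) : ℝ≥0∞ :=
  ∑' (n : ℕ) (p : ℕ) (t : fullyParked n p), (x : ℝ≥0∞) ^ n * (y : ℝ≥0∞) ^ p * t.1.weight μ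

end Parking

end

noncomputable section

namespace Parking

/-! ### Binary trees decorated by cars -/

/-! Write Φ_x(y) = 1 + F(x, y), the sum over binary trees decorated by cars of the weight `W` times
y to the flux, the empty tree counting 1 (`one_add_genF`). The equation reads 1 = μ₀ x Φ_x(0)². Let
X be the number of visitors of the root and q = P(X = 0).

From finite clusters to the equation, with x = q. A binary tree with n vertices has n + 1 boundary
vertices, so a fully parked tree t is the cluster of the root with probability q^(n+1) w(t)
(`lintegral_exists_lowCluster`). If the clusters are finite, then P(X ≤ 1) = q Φ_q(0). Moreover the
root is empty when it receives no car and each child has at most one visitor, so q = μ₀ P(X ≤ 1)²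
(`emptyProb_eq`); divide by q.

From the equation to subcriticality. The equation says exactly that the image of the weights under
the number of visits solves, up to normalization, the recursive equation of X (`tsum_fixed`). In
generating functions, x G Φ² = yΦ + 1 − y, where G is the generating function of μ. Positivity of
the Taylor coefficients turns this relation into a lower bound on the radius of convergence, and a
bootstrap gives Φ(z) < ∞ for some z > 1 (`exists_one_lt_Phi_ne_top`). Hence xΦ(1) = 1 and the
stationary law is a probability with finite mean. Parking on finitely many generations amounts to
iterating a monotone recursion from 0, so X is dominated by the stationary law
(`lintegral_rootVisits_le`): E[X] < ∞ and x ≤ q (`le_emptyProb`). The cluster of the root is then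
finite with probability qΦ_q(1) ≥ xΦ_x(1) = 1. -/

/-- Finite binary trees decorated by numbers of cars, including the empty tree. -/
inductive CarTree : Type
  | nil : CarTree
  | node (k : ℕ) (l r : CarTree) : CarTree

namespace CarTree

/-- The number of cars that visit the root. -/
def vis : CarTree → ℕ
  | nil => 0
  | node k l r => k + (vis l - 1) + (vis r - 1)

/-- The outgoing flux. -/
def fl (t : CarTree) : ℕ := t.vis - 1

/-- The height, with value `0` at the empty tree. -/
def height : CarTree → ℕ
  | nil => 0
  | node _ l r => max l.height r.height + 1

/-- The weight of a tree at `x`, with value `0` when some vertex is not occupied. -/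
def W (μ : PMF ℕ) (x : ℝ≥0∞) : CarTree → ℝ≥0∞
  | nil => 1
  | node k l r => if 1 ≤ k + l.fl + r.fl then x * μ k * (W μ x l * W μ x r) else 0

/-- A tree is empty or consists of its root and of two subtrees. -/
def equivOption : Option (ℕ × CarTree × CarTree) ≃ CarTree where
  toFun o := o.elim nil fun p => node p.1 p.2.1 p.2.2
  invFun t := match t with
    | nil => none
    | node k l r => some (k, l, r)
  left_inv o := by cases o <;> rfl
  right_inv t := by cases t <;> rfl

lemma tsum_option_eq {α : Type*} (f : Option α → ℝ≥0∞) :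
    ∑' o, f o = f none + ∑' a, f (some a) := by
  rw [← (Equiv.optionEquivSumPUnit.{0} α).symm.tsum_eq f,
    ENNReal.summable.tsum_sum ENNReal.summable, add_comm]
  simp

lemma tsum_eq (f : CarTree → ℝ≥0∞) :
    ∑' t, f t = f nil + ∑' k, ∑' l, ∑' r, f (node k l r) := by
  rw [← equivOption.tsum_eq, tsum_option_eq]
  congr 1
  rw [ENNReal.tsum_prod' (f := fun p => f (equivOption (some p)))]
  refine tsum_congr fun k => ?_
  rw [ENNReal.tsum_prod' (f := fun p => f (equivOption (some (k, p))))]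
  rfl

/-! ### Generating functions of the weights and stationarity -/

variable (μ : PMF ℕ) (x : ℝ≥0∞)

/-- The generating function of the weights of all trees, counted by the flux. -/
def Phi (y : ℝ≥0∞) : ℝ≥0∞ := ∑' t : CarTree, W μ x t * y ^ t.fl

/-- The Taylor coefficient of order `k` of `Phi` at `y`. -/
def taylor (k : ℕ) (y : ℝ≥0∞) : ℝ≥0∞ :=
  ∑' t : CarTree, W μ x t * (t.fl.choose k * y ^ (t.fl - k))

lemma W_mono {x x' : ℝ≥0∞} (h : x ≤ x') (t : CarTree) : W μ x t ≤ W μ x' t := by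
  induction t with
  | nil => exact le_rfl
  | node k l r hl hr =>
    simp only [W]
    split_ifs
    · gcongr
    · exact le_rfl

lemma tsum_W_vis (g : ℕ → ℝ≥0∞) :
    ∑' t, W μ x t * g t.vis = g 0 + ∑' k, ∑' l : CarTree, ∑' r : CarTree,
      if 1 ≤ k + l.fl + r.fl then
        x * μ k * (W μ x l * W μ x r) * g (k + l.fl + r.fl) else 0 := by
  rw [tsum_eq]
  simp only [W, vis, one_mul, ite_mul, zero_mul]
  rfl

lemma Phi_zero : Phi μ x 0 = ∑' t : CarTree, if t.fl = 0 then W μ x t else 0 := by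
  refine tsum_congr fun t => ?_
  split_ifs with h
  · simp [h]
  · simp [h]

/-- The weights are stationary for the recursive equation of the visits of the root. -/
lemma tsum_fixed (h1 : 1 = μ 0 * x * Phi μ x 0 ^ 2) (g : ℕ → ℝ≥0∞) :
    ∑' k, ∑' l : CarTree, ∑' r : CarTree,
      x * μ k * (W μ x l * W μ x r) * g (k + l.fl + r.fl) = ∑' t, W μ x t * g t.vis := by
  -- The terms with no visitor at the root, which `W` kills, add up to μ₀ x Φ(0)² g(0) = g(0): they
  -- are exactly replaced by the empty tree.
  have h0 : g 0 = ∑' k, ∑' l : CarTree, ∑' r : CarTree,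
      if 1 ≤ k + l.fl + r.fl then 0 else
        x * μ k * (W μ x l * W μ x r) * g (k + l.fl + r.fl) := by
    rw [tsum_eq_single 0]
    · calc g 0 = μ 0 * x * Phi μ x 0 ^ 2 * g 0 := by rw [← h1, one_mul]
        _ = ∑' l : CarTree, ∑' r : CarTree, (x * μ 0 * g 0) *
            ((if l.fl = 0 then W μ x l else 0) * (if r.fl = 0 then W μ x r else 0)) := by
          simp only [ENNReal.tsum_mul_left, ENNReal.tsum_mul_right, ← Phi_zero]
          ring
        _ = _ := by
          refine tsum_congr fun l => tsum_congr fun r => ?_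
          by_cases hl : l.fl = 0 <;> by_cases hr : r.fl = 0 <;> simp [hl, hr, Nat.one_le_iff_ne_zero]
          ring
    · intro k hk
      simp [Nat.one_le_iff_ne_zero, hk]
  rw [tsum_W_vis, h0, ← ENNReal.tsum_add]
  refine tsum_congr fun k => ?_
  rw [← ENNReal.tsum_add]
  refine tsum_congr fun l => ?_
  rw [← ENNReal.tsum_add]
  refine tsum_congr fun r => ?_
  split_ifs <;> simp

/-! ### Convergence beyond 1: Taylor coefficients and bootstrap -/

/-- The generating function of the car arrivals. -/
def genG (y : ℝ≥0∞) : ℝ≥0∞ := ∑' k, μ k * y ^ k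

/-- Vandermonde's identity with only its two extreme terms kept; they are distinct because `k ≥ 1`.
-/
lemma choose_add_choose_le (k m i j : ℕ) (hk : 1 ≤ k) :
    i.choose k + j.choose k ≤ (m + i + j).choose k := by
  obtain ⟨k, rfl⟩ : ∃ k', k = k' + 1 := ⟨k - 1, by omega⟩
  have h1 : (i + j).choose (k + 1) ≤ (m + i + j).choose (k + 1) :=
    Nat.choose_le_choose _ (by omega)
  refine le_trans ?_ h1
  rw [Nat.add_choose_eq]
  have : ∑ p ∈ ({(k + 1, 0), (0, k + 1)} : Finset (ℕ × ℕ)), i.choose p.1 * j.choose p.2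
      ≤ ∑ p ∈ Finset.HasAntidiagonal.antidiagonal (k + 1), i.choose p.1 * j.choose p.2 := by
    apply Finset.sum_le_sum_of_subset
    intro p hp
    simp only [Finset.mem_insert, Finset.mem_singleton] at hp
    rcases hp with rfl | rfl <;> simp
  rw [Finset.sum_pair (by simp)] at this
  simpa using this

lemma choose_mul_pow_le (y : ℝ≥0∞) (k m i j : ℕ) (hk : 1 ≤ k) :
    y ^ m * (y ^ j * (i.choose k * y ^ (i - k))) + y ^ m * (y ^ i * (j.choose k * y ^ (j - k)))
      ≤ (m + i + j).choose k * y ^ (m + i + j - k) := by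
  have key : ∀ i j : ℕ, y ^ m * (y ^ j * ((i.choose k : ℝ≥0∞) * y ^ (i - k)))
      = i.choose k * y ^ (m + i + j - k) := by
    intro i j
    by_cases h : k ≤ i
    · rw [show m + i + j - k = m + j + (i - k) by omega, pow_add, pow_add]; ring
    · simp [Nat.choose_eq_zero_of_lt (not_le.1 h)]
  rw [key i j, key j i, show m + j + i = m + i + j by omega, ← add_mul]
  gcongr
  exact_mod_cast choose_add_choose_le k m i j hk

/-- Leibniz rule for y^v = y · y^(v-1). It is an equality for `v ≥ 1`; only the empty tree, with `v
= 0`, makes it an inequality. -/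
lemma choose_pow_le (y : ℝ≥0∞) (k v : ℕ) :
    (v.choose (k + 1) : ℝ≥0∞) * y ^ (v - (k + 1)) ≤
      y * ((v - 1).choose (k + 1) * y ^ (v - 1 - (k + 1)))
        + (v - 1).choose k * y ^ (v - 1 - k) := by
  rcases v with _ | v
  · simp
  · rw [Nat.choose_succ_succ, Nat.add_sub_cancel, Nat.cast_add, add_mul, add_comm]
    refine add_le_add ?_ ?_
    · by_cases h : k + 1 ≤ v
      · rw [show v + 1 - (k + 1) = v - (k + 1) + 1 by omega, pow_succ]
        exact le_of_eq (by rw [Nat.succ_eq_add_one]; ring)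
      · simp [Nat.choose_eq_zero_of_lt (not_le.1 h)]
    · rw [show v + 1 - (k + 1) = v - k by omega]

lemma tsum_triple (f : ℕ → ℝ≥0∞) (u v : CarTree → ℝ≥0∞) :
    ∑' k, ∑' l : CarTree, ∑' r : CarTree, x * μ k * (W μ x l * W μ x r) * (f k * (v r * u l))
      = x * (∑' k, μ k * f k) * (∑' l, W μ x l * u l) * (∑' r, W μ x r * v r) := by
  have : ∀ (k : ℕ) (l r : CarTree), x * μ k * (W μ x l * W μ x r) * (f k * (v r * u l))
      = x * (μ k * f k) * ((W μ x l * u l) * (W μ x r * v r)) := fun k l r => by ring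
  simp only [this, ENNReal.tsum_mul_left, ENNReal.tsum_mul_right]
  ring

variable {μ x}

/-- Compare the Taylor coefficients of order k + 1 of both sides of x G Φ² = Σ W y^vis. On the left
keep only the Leibniz terms where all derivatives fall on one of the two factors Φ. Both sides may
be infinite here. -/
lemma taylor_rec (h1 : 1 = μ 0 * x * Phi μ x 0 ^ 2) (y : ℝ≥0∞) (k : ℕ) :
    2 * (x * genG μ y * Phi μ x y) * taylor μ x (k + 1) y
      ≤ y * taylor μ x (k + 1) y + taylor μ x k y := by
  calc _ = (∑' m, ∑' l : CarTree, ∑' r : CarTree, x * μ m * (W μ x l * W μ x r) *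
          (y ^ m * (y ^ r.fl * (l.fl.choose (k + 1) * y ^ (l.fl - (k + 1)))))) +
          (∑' m, ∑' l : CarTree, ∑' r : CarTree, x * μ m * (W μ x l * W μ x r) *
          (y ^ m * ((r.fl.choose (k + 1) * y ^ (r.fl - (k + 1))) * y ^ l.fl))) := by
        rw [tsum_triple, tsum_triple]
        simp only [taylor, genG, Phi]
        ring
    _ ≤ ∑' m, ∑' l : CarTree, ∑' r : CarTree, x * μ m * (W μ x l * W μ x r) *
          ((m + l.fl + r.fl).choose (k + 1) * y ^ (m + l.fl + r.fl - (k + 1))) := by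
        simp only [← ENNReal.tsum_add]
        refine ENNReal.tsum_le_tsum fun m => ENNReal.tsum_le_tsum fun l =>
          ENNReal.tsum_le_tsum fun r => ?_
        rw [← mul_add]
        gcongr
        refine le_trans (le_of_eq ?_) (choose_mul_pow_le y (k + 1) m l.fl r.fl (by omega))
        ring
    _ = ∑' t : CarTree, W μ x t * (t.vis.choose (k + 1) * y ^ (t.vis - (k + 1))) :=
        tsum_fixed μ x h1 (fun v => v.choose (k + 1) * y ^ (v - (k + 1)))
    _ ≤ _ := by
        simp only [taylor, ← ENNReal.tsum_mul_left, ← ENNReal.tsum_add]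
        refine ENNReal.tsum_le_tsum fun t => ?_
        refine (mul_le_mul_right (choose_pow_le y k t.vis) (W μ x t)).trans (le_of_eq ?_)
        simp only [fl]
        ring

lemma taylor_zero (y : ℝ≥0∞) : taylor μ x 0 y = Phi μ x y := by
  simp [taylor, Phi]

/-- The terms are nonnegative, so the sums can be exchanged whether or not the series converges. -/
lemma Phi_add (y h : ℝ≥0∞) : Phi μ x (y + h) = ∑' k, taylor μ x k y * h ^ k := by
  simp only [taylor, Phi, ← ENNReal.tsum_mul_right]
  rw [ENNReal.tsum_comm]
  refine tsum_congr fun t => ?_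
  rw [add_comm y h, add_pow, tsum_eq_sum (s := Finset.range (t.fl + 1)), Finset.mul_sum]
  · refine Finset.sum_congr rfl fun k _ => ?_
    ring
  · intro k hk
    rw [Nat.choose_eq_zero_of_lt (by simpa using hk)]
    simp

lemma one_le_Phi (y : ℝ≥0∞) : 1 ≤ Phi μ x y := by
  rw [Phi, tsum_eq]
  simp [W, fl, vis]

lemma Phi_mono {y y' : ℝ≥0∞} (h : y ≤ y') : Phi μ x y ≤ Phi μ x y' :=
  ENNReal.tsum_le_tsum fun t => by gcongr

lemma Phi_fixed (h1 : 1 = μ 0 * x * Phi μ x 0 ^ 2) (y : ℝ≥0∞) :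
    x * genG μ y * Phi μ x y * Phi μ x y = ∑' t : CarTree, W μ x t * y ^ t.vis := by
  rw [← tsum_fixed μ x h1 (fun v => y ^ v)]
  simp only [genG, Phi, ← tsum_triple]
  refine tsum_congr fun m => tsum_congr fun l => tsum_congr fun r => ?_
  ring

/-- A geometric bound for the Taylor coefficients gives convergence. -/
lemma Phi_add_ne_top {y c h : ℝ≥0∞} (hy : Phi μ x y ≠ ∞) (hc : c ≠ ∞) (hh : h < c)
    (hrec : ∀ k, c * taylor μ x (k + 1) y ≤ taylor μ x k y) : Phi μ x (y + h) ≠ ∞ := by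
  have hc0 : c ≠ 0 := (bot_le.trans_lt hh).ne'
  have hk : ∀ k, taylor μ x k y * h ^ k ≤ Phi μ x y * (h / c) ^ k := by
    intro k
    have : c ^ k * taylor μ x k y ≤ Phi μ x y := by
      induction k with
      | zero => simp [taylor_zero]
      | succ k ih =>
        refine le_trans ?_ ih
        rw [pow_succ, mul_assoc]
        gcongr
        exact hrec k
    calc taylor μ x k y * h ^ k = (c ^ k * taylor μ x k y) * (h / c) ^ k := by
          rw [ENNReal.div_eq_inv_mul, mul_pow, ← ENNReal.inv_pow]
          rw [show c ^ k * taylor μ x k y * ((c ^ k)⁻¹ * h ^ k)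
            = (c ^ k * (c ^ k)⁻¹) * (taylor μ x k y * h ^ k) by ring]
          rw [ENNReal.mul_inv_cancel (pow_ne_zero _ hc0) (ENNReal.pow_ne_top hc), one_mul]
      _ ≤ _ := by gcongr
  rw [Phi_add]
  refine ne_top_of_le_ne_top ?_ (ENNReal.tsum_le_tsum hk)
  rw [ENNReal.tsum_mul_left, ENNReal.tsum_geometric]
  refine ENNReal.mul_ne_top hy (ENNReal.inv_ne_top.2 ?_)
  rw [Ne, tsub_eq_zero_iff_le, not_le]
  exact (ENNReal.div_lt_iff (Or.inl hc0) (Or.inl hc)).2 (by simpa using hh)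

lemma exists_Phi_ne_top (h1 : 1 = μ 0 * x * Phi μ x 0 ^ 2) (h0 : Phi μ x 0 ≠ ∞) :
    ∃ y, y ≠ 0 ∧ y ≠ ∞ ∧ Phi μ x y ≠ ∞ := by
  set c := x * genG μ 0 * Phi μ x 0 with hc
  have hG : genG μ 0 = μ 0 := by
    rw [genG, tsum_eq_single 0]
    · simp
    · intro k hk; simp [hk]
  have hcp : c * Phi μ x 0 = 1 := by rw [h1, hc, hG]; ring
  have hc0 : c ≠ 0 := by rintro h; simp [h] at hcp
  have hct : c ≠ ∞ := by
    intro h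
    rw [h, ENNReal.top_mul (by intro h'; simp [h'] at hcp)] at hcp
    exact ENNReal.top_ne_one hcp
  -- At y = 0 the recursion for the Taylor coefficients has ratio 2c, so the series converges below
  -- 2c, in particular at c.
  refine ⟨c, hc0, hct, ?_⟩
  rw [← zero_add c]
  refine Phi_add_ne_top (c := 2 * c) h0 (ENNReal.mul_ne_top (by simp) hct) ?_ fun k => ?_
  · rw [two_mul]; exact ENNReal.lt_add_right hct hc0
  · simpa using taylor_rec h1 0 k

lemma taylor_ne_top {y h : ℝ≥0∞} (hh : h ≠ 0) (hy : Phi μ x (y + h) ≠ ∞) (k : ℕ) :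
    taylor μ x k y ≠ ∞ := by
  intro ht
  rw [Phi_add] at hy
  refine ENNReal.ne_top_of_tsum_ne_top hy k ?_
  rw [ht, ENNReal.top_mul (pow_ne_zero _ hh)]

/-- For y ≤ 1 the fixed point equation gives x G Φ ≥ y, so the Taylor coefficients at y decrease at
least like y^(-k). Finiteness slightly above y thus propagates to everything below 2y. -/
lemma Phi_step (h1 : 1 = μ 0 * x * Phi μ x 0 ^ 2) {y h h' : ℝ≥0∞} (hy1 : y ≤ 1)
    (hh : h ≠ 0) (hy : Phi μ x (y + h) ≠ ∞) (hh' : h' < y) : Phi μ x (y + h') ≠ ∞ := by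
  have hyt : y ≠ ∞ := ne_top_of_le_ne_top ENNReal.one_ne_top hy1
  have hPy : Phi μ x y ≠ ∞ := ne_top_of_le_ne_top hy (Phi_mono le_self_add)
  have hP0 : Phi μ x y ≠ 0 := (zero_lt_one.trans_le (one_le_Phi y)).ne'
  refine Phi_add_ne_top hPy hyt hh' fun k => ?_
  -- Since `vis ≤ fl + 1` and y ≤ 1, Σ W y^vis ≥ yΦ(y); cancel one factor Φ(y).
  have hG : y ≤ x * genG μ y * Phi μ x y := by
    rw [← ENNReal.mul_le_mul_iff_left hP0 hPy, Phi_fixed h1, Phi, ← ENNReal.tsum_mul_left]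
    refine ENNReal.tsum_le_tsum fun t => ?_
    rw [mul_left_comm, ← pow_succ']
    gcongr W μ x t * ?_
    exact pow_le_pow_right_of_le_one' hy1 (by simp only [fl]; omega)
  have h2 := taylor_rec h1 y k
  -- The margin `h` makes this coefficient finite, which allows cancelling it in `h3`.
  have hk := taylor_ne_top hh hy (k + 1)
  have h3 : y * taylor μ x (k + 1) y + y * taylor μ x (k + 1) y
      ≤ y * taylor μ x (k + 1) y + taylor μ x k y := by
    refine le_trans ?_ h2
    rw [← two_mul, ← mul_assoc]
    gcongr
  exact (ENNReal.add_le_add_iff_left (ENNReal.mul_ne_top hyt hk)).1 h3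

lemma exists_one_lt_Phi_ne_top (h1 : 1 = μ 0 * x * Phi μ x 0 ^ 2) (h0 : Phi μ x 0 ≠ ∞) :
    ∃ z, 1 < z ∧ Phi μ x z ≠ ∞ := by
  obtain ⟨y, hy0, hyt, hy⟩ := exists_Phi_ne_top h1 h0
  by_contra! hcon
  lift y to ℝ≥0 using hyt
  have hy0' : 0 < y := by simpa [pos_iff_ne_zero] using hy0
  have key : ∀ n : ℕ, Phi μ x ((y * (5 / 4) ^ n : ℝ≥0) : ℝ≥0∞) ≠ ∞ := by
    intro n
    induction n with
    | zero => simpa using hy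
    | succ n ih =>
      set z : ℝ≥0 := y * (5 / 4) ^ n with hz
      have hzp : 0 < z := by positivity
      have hz1 : z ≤ 1 := by
        by_contra! h
        exact ih (hcon z (by exact_mod_cast h))
      -- From finiteness at z ≤ 1, expand at 3z/4, leaving the margin z/4, and advance by z/2 <
      -- 3z/4: this reaches 5z/4.
      have := Phi_step h1 (y := ((3 / 4 * z : ℝ≥0) : ℝ≥0∞)) (h := ((1 / 4 * z : ℝ≥0) : ℝ≥0∞))
        (h' := ((1 / 2 * z : ℝ≥0) : ℝ≥0∞)) ?_ ?_ ?_ ?_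
      · rw [← ENNReal.coe_add] at this
        convert this using 3
        rw [pow_succ, ← mul_assoc, ← hz, ← add_mul, mul_comm]
        congr 1
        ext; norm_num
      · have : 3 / 4 * z ≤ 1 := by
          rw [← NNReal.coe_le_coe] at hz1 ⊢
          push_cast at *; linarith
        exact_mod_cast this
      · have : (1 / 4 * z) ≠ 0 := by positivity
        exact_mod_cast this
      · rw [← ENNReal.coe_add]
        convert ih using 3
        ext; push_cast; ring
      · have : 1 / 2 * z < 3 / 4 * z := by
          rw [← NNReal.coe_lt_coe] at hzp ⊢
          push_cast at *; linarith
        exact_mod_cast this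
  obtain ⟨n, hn⟩ := pow_unbounded_of_one_lt (1 / (y : ℝ)) (show (1 : ℝ) < 5 / 4 by norm_num)
  refine key n (hcon _ ?_)
  rw [div_lt_iff₀ (by exact_mod_cast hy0')] at hn
  have : 1 < y * (5 / 4) ^ n := by
    rw [← NNReal.coe_lt_coe]
    push_cast; linarith
  exact_mod_cast this

lemma Phi_one_ne_top (h1 : 1 = μ 0 * x * Phi μ x 0 ^ 2) (h0 : Phi μ x 0 ≠ ∞) :
    Phi μ x 1 ≠ ∞ := by
  obtain ⟨z, hz, hzt⟩ := exists_one_lt_Phi_ne_top h1 h0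
  exact ne_top_of_le_ne_top hzt (Phi_mono hz.le)

/-! ### Total mass and mean of the stationary weights -/

lemma Phi_one_eq : Phi μ x 1 = ∑' t : CarTree, W μ x t := by simp [Phi]

/-- The stationary weights have total mass one. -/
lemma mul_Phi_one (h1 : 1 = μ 0 * x * Phi μ x 0 ^ 2) (h0 : Phi μ x 0 ≠ ∞) :
    x * Phi μ x 1 = 1 := by
  have hP := Phi_one_ne_top h1 h0
  have hP0 : Phi μ x 1 ≠ 0 := (zero_lt_one.trans_le (one_le_Phi 1)).ne'
  have := Phi_fixed h1 1
  have hG : genG μ 1 = 1 := by simp [genG, μ.tsum_coe]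
  rw [hG] at this
  simp only [one_pow, mul_one] at this
  rw [← Phi_one_eq] at this
  nth_rewrite 3 [← one_mul (Phi μ x 1)] at this
  exact (ENNReal.mul_left_inj hP0 hP).1 this

/-- The stationary weights have a finite mean. -/
lemma tsum_W_mul_vis_ne_top (h1 : 1 = μ 0 * x * Phi μ x 0 ^ 2) (h0 : Phi μ x 0 ≠ ∞) :
    ∑' t : CarTree, W μ x t * t.vis ≠ ∞ := by
  obtain ⟨z, hz, hzt⟩ := exists_one_lt_Phi_ne_top h1 h0
  have ht : taylor μ x 1 1 ≠ ∞ := by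
    refine taylor_ne_top (h := z - 1) (tsub_pos_of_lt hz).ne' ?_ 1
    rwa [add_tsub_cancel_of_le hz.le]
  refine ne_top_of_le_ne_top (ENNReal.add_ne_top.2 ⟨ht, Phi_one_ne_top h1 h0⟩) ?_
  rw [taylor, Phi, ← ENNReal.tsum_add]
  refine ENNReal.tsum_le_tsum fun t => ?_
  simp only [Nat.choose_one_right, one_pow, mul_one]
  nth_rewrite 3 [← mul_one (W μ x t)]
  rw [← mul_add]
  gcongr
  have : t.vis ≤ t.fl + 1 := by simp only [fl]; omega
  exact_mod_cast this

end CarTree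

/-! ### Connected sets of vertices -/

lemma adj_append (u : Vertex) (b : Bool) : binaryTree.Adj u (u ++ [b]) := by
  rw [binaryTree, SimpleGraph.fromRel_adj]
  exact ⟨by simp, Or.inl ⟨b, rfl⟩⟩

lemma adj_iff (u v : Vertex) :
    binaryTree.Adj u v ↔ (∃ b : Bool, v = u ++ [b]) ∨ ∃ b : Bool, u = v ++ [b] := by
  rw [binaryTree, SimpleGraph.fromRel_adj]
  refine ⟨fun h => h.2, fun h => ⟨?_, h⟩⟩
  rintro rfl
  rcases h with ⟨b, h⟩ | ⟨b, h⟩ <;> simp at h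

/-- The part of the set `s` above `u` that is connected to `u`. -/
def above (s : Set Vertex) (u : Vertex) : Set Vertex :=
  {w | u <+: w ∧ ∀ p, u <+: p → p <+: w → p ∈ s}

/-- A connected subset of `s` that meets `above s u` stays in it, unless the parent of `u` is in
`s`. -/
lemma mem_above_of_reachable {s : Set Vertex} {u : Vertex}
    (hu : ∀ (p : Vertex) (b : Bool), u = p ++ [b] → p ∉ s) {v w : s}
    (h : (binaryTree.induce s).Reachable v w) (hv : (v : Vertex) ∈ above s u) :
    (w : Vertex) ∈ above s u := by
  rw [SimpleGraph.reachable_iff_reflTransGen] at h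
  induction h with
  | refl => exact hv
  | @tail p q _ hpq ih =>
    have hpq' : binaryTree.Adj (p : Vertex) q := hpq
    rcases (adj_iff _ _).1 hpq' with ⟨b, hb⟩ | ⟨b, hb⟩
    · refine ⟨ih.1.trans (hb ▸ List.prefix_append _ _), fun r hur hrq => ?_⟩
      rw [hb, List.prefix_concat_iff] at hrq
      rcases hrq with rfl | hrq
      · rw [← hb]; exact q.2
      · exact ih.2 r hur hrq
    · have h1 := ih.1
      rw [hb, List.prefix_concat_iff] at h1
      rcases h1 with h1 | h1
      · exact absurd q.2 (hu _ b (by simpa using h1))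
      · exact ⟨h1, fun r hur hrq => ih.2 r hur (hrq.trans (hb ▸ List.prefix_append _ _))⟩

/-- A connected set of vertices that contains the root is closed under taking parents. -/
lemma mem_of_append_mem {s : Set Vertex} (hs : (binaryTree.induce s).Connected) (h0 : [] ∈ s)
    {u : Vertex} {b : Bool} (hu : u ++ [b] ∈ s) : u ∈ s := by
  by_contra hcon
  -- If the parent were missing, a path to the root could not leave the part of `s` above `u ++
  -- [b]`, which does not contain the root.
  have hr : (binaryTree.induce s).Reachable ⟨u ++ [b], hu⟩ ⟨[], h0⟩ := hs.preconnected _ _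
  have := mem_above_of_reachable (u := u ++ [b]) (fun p c h => ?_) hr
    ⟨List.prefix_rfl, fun p hp hp' => ?_⟩
  · simpa using this.1.length_le
  · rwa [← (List.append_inj' h rfl).1]
  · rwa [← List.IsPrefix.eq_of_length hp (le_antisymm hp.length_le hp'.length_le)]

lemma connected_of_append_mem {s : Set Vertex} (h0 : [] ∈ s)
    (hs : ∀ (u : Vertex) (b : Bool), u ++ [b] ∈ s → u ∈ s) :
    (binaryTree.induce s).Connected := by
  have key : ∀ u : Vertex, ∀ hu : u ∈ s, (binaryTree.induce s).Reachable ⟨[], h0⟩ ⟨u, hu⟩ := by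
    intro u
    induction u using List.reverseRecOn with
    | nil => intro hu; exact SimpleGraph.Reachable.refl _
    | append_singleton u b ih =>
      intro hu
      refine (ih (hs u b hu)).trans (SimpleGraph.Adj.reachable ?_)
      exact adj_append u b
  rw [SimpleGraph.connected_iff]
  exact ⟨fun u v => (key u u.2).symm.trans (key v v.2), ⟨⟨[], h0⟩⟩⟩

/-! ### The recursion for the visits -/

/-- The balance equation determines the values at a height from those one step higher, and both
solutions vanish far from the root. -/
lemma visits_unique_aux {c v w : Vertex → ℕ} {N : ℕ}
    (hv : ∀ u, v u = c u + ∑ b : Bool, (v (u ++ [b]) - 1))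
    (hw : ∀ u, w u = c u + ∑ b : Bool, (w (u ++ [b]) - 1))
    (hv0 : ∀ u, N < u.length → v u = 0) (hw0 : ∀ u, N < u.length → w u = 0) : v = w := by
  have key : ∀ k : ℕ, ∀ u : Vertex, N < u.length + k → v u = w u := by
    intro k
    induction k with
    | zero => intro u hu; rw [hv0 u hu, hw0 u hu]
    | succ k ih =>
      intro u hu
      rw [hv, hw]
      congr 1
      refine Finset.sum_congr rfl fun b _ => ?_
      rw [ih (u ++ [b]) (by simp; omega)]
  exact funext fun u => key (N + 1) u (by omega)

lemma count_carList (s : Finset Vertex) (a : Vertex → ℕ) (u : Vertex) :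
    (carList s a).count u = if u ∈ s then a u else 0 := by
  rw [carList, List.count_flatMap]
  have : (List.count u ∘ fun u => List.replicate (a u) u)
      = fun v => if v = u then a v else 0 := by
    funext v
    simp [List.count_replicate]
  rw [this, Finset.sum_map_toList]
  simp

/-- The visits are determined by the mass balance. -/
lemma visits_eq_of_rec {s : Finset Vertex} {a v : Vertex → ℕ} (N : ℕ)
    (hs : ∀ u ∈ s, u.length ≤ N) (hv0 : ∀ u, N < u.length → v u = 0)
    (hv : ∀ u, v u = (if u ∈ s then a u else 0) + ∑ b : Bool, (v (u ++ [b]) - 1)) :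
    visits s a = v := by
  refine visits_unique_aux (c := fun u => if u ∈ s then a u else 0) (N := N) (fun u => ?_) hv
    (park_visits_far _ N fun u hu => ?_) hv0
  · rw [← count_carList]
    exact park_visits_eq _ u
  · simp only [carList, List.mem_flatMap, Finset.mem_toList, List.mem_replicate] at hu
    obtain ⟨w, hw, -, rfl⟩ := hu
    exact hs _ hw

namespace CarTree

/-! ### Fully parked trees as decorated binary trees -/

/-- The subtree above a vertex, empty when the vertex is not in the tree. -/
def sub : CarTree → Vertex → CarTree
  | t, [] => t
  | nil, _ :: _ => nil
  | node _ l r, b :: u => sub (bif b then r else l) u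

/-- The vertices of a tree. -/
def verts : CarTree → Finset Vertex
  | nil => ∅
  | node _ l r => insert [] (l.verts.image (List.cons false) ∪ r.verts.image (List.cons true))

/-- The cars that arrive on the root. -/
def rootCars : CarTree → ℕ
  | nil => 0
  | node k _ _ => k

@[simp] lemma sub_empty (t : CarTree) : sub t [] = t := by cases t <;> rfl

@[simp] lemma sub_nil (u : Vertex) : sub nil u = nil := by cases u <;> rfl

@[simp] lemma sub_node_cons (k : ℕ) (l r : CarTree) (b : Bool) (u : Vertex) :
    sub (node k l r) (b :: u) = sub (bif b then r else l) u := rfl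

lemma mem_verts {t : CarTree} {u : Vertex} : u ∈ t.verts ↔ sub t u ≠ nil := by
  induction t generalizing u with
  | nil => simp [verts]
  | node k l r hl hr =>
    rcases u with _ | ⟨_ | _, u⟩ <;> simp [verts, hl, hr]

lemma sub_append (t : CarTree) (u w : Vertex) : sub t (u ++ w) = sub (sub t u) w := by
  induction u generalizing t with
  | nil => simp
  | cons b u ih => cases t <;> simp [ih]

/-- The car arrivals on the vertices of a tree. -/
def arrivals (t : CarTree) : Vertex →₀ ℕ :=
  Finsupp.onFinset t.verts (fun u => (sub t u).rootCars) fun u hu => by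
    rw [mem_verts]
    intro h
    rw [h] at hu
    exact hu rfl

lemma arrivals_apply (t : CarTree) (u : Vertex) : t.arrivals u = (sub t u).rootCars := rfl

lemma vis_eq (t : CarTree) : t.vis = t.rootCars + ∑ b : Bool, ((sub t [b]).vis - 1) := by
  cases t with
  | nil => simp [vis, rootCars]
  | node k l r => simp [vis, rootCars]; omega

lemma visits_verts (t : CarTree) (u : Vertex) :
    visits t.verts t.arrivals u = (sub t u).vis := by
  have hN : ∀ u ∈ t.verts, u.length ≤ t.verts.sup List.length := fun u hu => Finset.le_sup hu
  rw [visits_eq_of_rec (v := fun u => (sub t u).vis) _ hN]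
  · intro u hu
    have : u ∉ t.verts := fun h => absurd (hN u h) (not_le.2 hu)
    rw [mem_verts, not_not] at this
    simp [this, vis]
  · intro u
    simp only [sub_append]
    rw [vis_eq]
    congr 1
    split_ifs with h
    · rfl
    · rw [mem_verts, not_not] at h
      rw [h]; rfl

/-- All the vertices are occupied. -/
def Good : CarTree → Prop
  | nil => True
  | node k l r => 1 ≤ k + l.fl + r.fl ∧ Good l ∧ Good r

lemma good_iff (t : CarTree) : t.Good ↔ ∀ u ∈ t.verts, 1 ≤ (sub t u).vis := by
  induction t with
  | nil => simp [Good, verts]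
  | node k l r hl hr =>
    simp only [Good, hl, hr, verts, Finset.mem_insert, Finset.mem_union,
      or_imp, forall_and, Finset.forall_mem_image, sub_node_cons, cond_true, cond_false, forall_eq]
    rfl

variable {μ : PMF ℕ} {x : ℝ≥0∞}

lemma W_of_not_good {t : CarTree} (h : ¬ t.Good) : W μ x t = 0 := by
  induction t with
  | nil => exact absurd trivial h
  | node k l r hl hr =>
    simp only [W]
    split_ifs with h1
    · by_cases h2 : l.Good
      · rw [hr fun h3 => h ⟨h1, h2, h3⟩]; simp
      · rw [hl h2]; simp
    · rfl

lemma verts_prod (k : ℕ) (l r : CarTree) (f : Vertex → ℝ≥0∞) :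
    ∏ u ∈ (node k l r).verts, f u
      = f [] * ((∏ u ∈ l.verts, f (false :: u)) * ∏ u ∈ r.verts, f (true :: u)) := by
  rw [verts, Finset.prod_insert (by simp), Finset.prod_union, Finset.prod_image (by simp),
    Finset.prod_image (by simp)]
  rw [Finset.disjoint_left]
  simp

lemma W_of_good {t : CarTree} (h : t.Good) :
    W μ x t = x ^ t.verts.card * ∏ u ∈ t.verts, μ (t.arrivals u) := by
  rw [← Finset.prod_const, ← Finset.prod_mul_distrib]
  induction t with
  | nil => simp [verts, W]
  | node k l r hl hr =>
    rw [W, if_pos h.1, verts_prod, hl h.2.1, hr h.2.2]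
    rfl

lemma append_mem_verts {t : CarTree} {u : Vertex} {b : Bool} (h : u ++ [b] ∈ t.verts) :
    u ∈ t.verts := by
  rw [mem_verts, sub_append] at h
  rw [mem_verts]
  intro h'
  simp [h'] at h

/-- The fully parked tree given by a decorated binary tree. -/
def toFullyParked (t : {t : CarTree // t ≠ nil ∧ t.Good}) : FullyParkedTree where
  verts := t.1.verts
  root_mem := by simpa [mem_verts] using t.2.1
  connected := connected_of_append_mem (by simpa [mem_verts] using t.2.1)
    fun u b h => append_mem_verts h
  arrivals := t.1.arrivals
  support_subset := Finsupp.support_onFinset_subset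
  parked u hu := by
    rw [visits_verts]
    exact (good_iff _).1 t.2.2 u hu

lemma ext_of_sub {t t' : CarTree} (h : ∀ u, sub t u = nil ↔ sub t' u = nil)
    (h' : ∀ u, (sub t u).rootCars = (sub t' u).rootCars) : t = t' := by
  induction t generalizing t' with
  | nil =>
    have := h []
    simp at this
    exact this.symm
  | node k l r hl hr =>
    cases t' with
    | nil => simpa using h []
    | node k' l' r' =>
      have hk := h' []
      simp only [sub_empty, rootCars] at hk
      rw [hk, hl (fun u => h (false :: u)) (fun u => h' (false :: u)),
        hr (fun u => h (true :: u)) (fun u => h' (true :: u))]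
      rfl

/-- Surjectivity of the encoding: a set of bounded height closed under parents is built as a tree by
recursion on the height. -/
lemma exists_sub (a : Vertex → ℕ) (N : ℕ) (s : Set Vertex) (hN : ∀ u ∈ s, u.length < N)
    (hs : ∀ (u : Vertex) (b : Bool), u ++ [b] ∈ s → u ∈ s) :
    ∃ t : CarTree, ∀ u, (sub t u ≠ nil ↔ u ∈ s) ∧ (u ∈ s → (sub t u).rootCars = a u) := by
  induction N generalizing s a with
  | zero => exact ⟨nil, fun u => ⟨by simpa using fun h => absurd (hN u h) (by simp),
      fun h => absurd (hN u h) (by simp)⟩⟩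
  | succ N ih =>
    by_cases h0 : [] ∈ s
    · have := fun b : Bool => ih (fun u => a (b :: u)) {u | b :: u ∈ s}
        (fun u hu => by simpa using hN _ hu) (fun u c hu => hs (b :: u) c hu)
      choose t ht using this
      refine ⟨node (a []) (t false) (t true), ?_⟩
      rintro (_ | ⟨b, u⟩)
      · simp [h0, rootCars]
      · have := ht b u
        cases b <;> simpa using this
    · refine ⟨nil, fun u => ?_⟩
      have : u ∉ s := by
        induction u using List.reverseRecOn with
        | nil => exact h0
        | append_singleton u b ihu => exact fun h => ihu (hs u b h)
      simp [this]

lemma toFullyParked_bijective : Function.Bijective toFullyParked := by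
  constructor
  · intro t t' h
    have hv : t.1.verts = t'.1.verts := congrArg FullyParkedTree.verts h
    have ha : t.1.arrivals = t'.1.arrivals := congrArg FullyParkedTree.arrivals h
    refine Subtype.ext (ext_of_sub (fun u => ?_) fun u => ?_)
    · rw [← not_iff_not, ← Ne, ← mem_verts, ← Ne, ← mem_verts, hv]
    · rw [← arrivals_apply, ha, arrivals_apply]
  · intro f
    obtain ⟨t, ht⟩ := exists_sub f.arrivals (f.verts.sup List.length + 1) f.verts
      (fun u hu => Nat.lt_succ_of_le (Finset.le_sup (f := List.length) hu))
      (fun u b hu => mem_of_append_mem f.connected f.root_mem hu)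
    have hv : t.verts = f.verts := by
      ext u
      rw [mem_verts, (ht u).1, Finset.mem_coe]
    have ha : t.arrivals = f.arrivals := by
      ext u
      rw [arrivals_apply]
      by_cases hu : u ∈ f.verts
      · exact (ht u).2 hu
      · have h1 := mt (ht u).1.1 hu
        rw [not_not] at h1
        rw [h1, Finsupp.notMem_support_iff.1 fun h => hu (f.support_subset h)]
        rfl
    have h0 : t ≠ nil := by
      have := (ht []).1.2 f.root_mem
      simpa using this
    have hg : t.Good := by
      rw [good_iff]
      intro u hu
      rw [← visits_verts, hv, ha]
      exact f.parked u (hv ▸ hu)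
    refine ⟨⟨t, h0, hg⟩, ?_⟩
    rcases f with ⟨fv, _, _, fa, _, _⟩
    simp only at hv ha
    subst hv ha
    rfl

lemma genF_eq_tsum (μ : PMF ℕ) (x y : ℝ≥0) :
    genF μ x y = ∑' t : FullyParkedTree,
      (x : ℝ≥0∞) ^ t.verts.card * (y : ℝ≥0∞) ^ t.flux * t.weight μ := by
  rw [genF, ← ENNReal.tsum_fiberwise _ fun t : FullyParkedTree => (t.verts.card, t.flux),
    ENNReal.tsum_prod']
  refine tsum_congr fun n => tsum_congr fun p => ?_
  have : fullyParked n p = (fun t : FullyParkedTree => (t.verts.card, t.flux)) ⁻¹' {(n, p)} := by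
    ext t
    simp [fullyParked]
  rw [← this]
  refine tsum_congr fun t => ?_
  rw [t.2.1, t.2.2]

/-- The generating function of fully parked trees in terms of decorated binary trees. -/
lemma one_add_genF (μ : PMF ℕ) (x y : ℝ≥0) : 1 + genF μ x y = Phi μ x y := by
  classical
  rw [genF_eq_tsum, ← (Equiv.ofBijective _ toFullyParked_bijective).tsum_eq]
  have h1 : ∀ t : {t : CarTree // t ≠ nil ∧ t.Good},
      (x : ℝ≥0∞) ^ (toFullyParked t).verts.card * (y : ℝ≥0∞) ^ (toFullyParked t).flux
        * (toFullyParked t).weight μ = W μ x t.1 * (y : ℝ≥0∞) ^ t.1.fl := by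
    intro t
    rw [W_of_good t.2.2]
    have : (toFullyParked t).flux = t.1.fl := by
      rw [FullyParkedTree.flux]
      change visits t.1.verts t.1.arrivals [] - 1 = _
      rw [visits_verts, sub_empty]
      rfl
    rw [this, mul_right_comm]
    rfl
  simp only [Equiv.ofBijective_apply, h1]
  refine (congrArg (1 + ·) (tsum_subtype {t : CarTree | t ≠ nil ∧ t.Good}
    fun t => W μ x t * (y : ℝ≥0∞) ^ t.fl)).trans ?_
  rw [Phi, tsum_eq, tsum_eq (fun t => W μ x t * (y : ℝ≥0∞) ^ t.fl)]
  congr 1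
  · simp [W, fl, vis]
  · rw [Set.indicator_of_notMem (by simp), zero_add]
    refine tsum_congr fun k => tsum_congr fun l => tsum_congr fun r => ?_
    rw [Set.indicator_apply]
    split_ifs with h
    · rfl
    · have : ¬ (node k l r).Good := fun h' => h ⟨by simp, h'⟩
      rw [W_of_not_good this, zero_mul]

end CarTree

/-! ### The visits of the root -/

/-- The arrivals on the subtree above the vertex `u`. -/
def shift (u : Vertex) (a : Vertex → ℕ) : Vertex → ℕ := fun w => a (u ++ w)

/-- The visits of the root for the arrivals on the vertices of height less than `n`. -/
def rootVisits : ℕ → (Vertex → ℕ) → ℕ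
  | 0, _ => 0
  | n + 1, a => a [] + (rootVisits n (shift [false] a) - 1) + (rootVisits n (shift [true] a) - 1)

lemma rootVisits_mono (a : Vertex → ℕ) : Monotone fun n => rootVisits n a := by
  refine monotone_nat_of_le_succ fun n => ?_
  induction n generalizing a with
  | zero => exact Nat.zero_le _
  | succ n ih =>
    have h0 := ih (shift [false] a)
    have h1 := ih (shift [true] a)
    simp only [rootVisits] at h0 h1 ⊢
    omega

lemma mem_ball (n : ℕ) (u : Vertex) : u ∈ ball n ↔ u.length ≤ n := by
  simp [ball]

lemma shift_shift (u w : Vertex) (a : Vertex → ℕ) : shift w (shift u a) = shift (u ++ w) a := by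
  funext v
  simp [shift]

lemma visits_ball (n : ℕ) (a : Vertex → ℕ) (u : Vertex) :
    visits (ball n) a u = rootVisits (n + 1 - u.length) (shift u a) := by
  have hN : ∀ u ∈ ball n, u.length ≤ n := fun u hu => (mem_ball n u).1 hu
  rw [visits_eq_of_rec (v := fun u => rootVisits (n + 1 - u.length) (shift u a)) n hN]
  · intro u hu
    rw [show n + 1 - u.length = 0 by omega]
    rfl
  · intro u
    simp only [mem_ball]
    split_ifs with h
    · rw [show n + 1 - u.length = (n - u.length) + 1 by omega, rootVisits]
      simp [shift_shift, shift, add_assoc, add_comm]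
    · rw [show n + 1 - u.length = 0 by omega]
      simp [show n + 1 - (u.length + 1) = 0 by omega, rootVisits]

lemma totalVisits_eq (a : Vertex → ℕ) (u : Vertex) :
    totalVisits a u = ⨆ n, (rootVisits n (shift u a) : ℕ∞) := by
  refine le_antisymm (iSup_le fun n => ?_) (iSup_le fun n => ?_)
  · rw [visits_ball]
    exact le_iSup (fun n => (rootVisits n (shift u a) : ℕ∞)) _
  · refine le_iSup_of_le (n + u.length) ?_
    rw [visits_ball]
    exact_mod_cast rootVisits_mono _ (by omega)

/-- The number of cars that visit the root. -/
def rootTotal (a : Vertex → ℕ) : ℕ∞ := ⨆ n, (rootVisits n a : ℕ∞)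

lemma totalVisits_eq_rootTotal (a : Vertex → ℕ) (u : Vertex) :
    totalVisits a u = rootTotal (shift u a) := totalVisits_eq a u

lemma shift_nil (a : Vertex → ℕ) : shift [] a = a := rfl

lemma iSup_sub_one (f : ℕ → ℕ∞) : (⨆ n, f n) - 1 = ⨆ n, (f n - 1) := by
  refine le_antisymm ?_ (iSup_le fun n => tsub_le_tsub_right (le_iSup f n) 1)
  rw [tsub_le_iff_right]
  exact iSup_le fun n => tsub_le_iff_right.1 (le_iSup (fun n => f n - 1) n)

lemma rootTotal_eq (a : Vertex → ℕ) : rootTotal a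
    = a [] + (rootTotal (shift [false] a) - 1) + (rootTotal (shift [true] a) - 1) := by
  have hm : ∀ b : Bool, Monotone fun n => ((rootVisits n (shift [b] a) : ℕ∞) - 1) :=
    fun b n m h => tsub_le_tsub_right (by exact_mod_cast rootVisits_mono _ h) 1
  simp only [rootTotal, iSup_sub_one]
  -- Monotonicity lets the supremum pass through the sum; shifting the index by one then turns the
  -- limit into that of the recursion.
  rw [add_assoc, ENat.iSup_add_iSup_of_monotone (hm false) (hm true), ENat.add_iSup,
    ← Monotone.iSup_nat_add (k := 1) (f := fun n => (rootVisits n a : ℕ∞))]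
  · simp [rootVisits, add_assoc]
  · intro n m h
    exact Nat.cast_le.2 (rootVisits_mono a h)

/-- A finite supremum of integers is attained. This form exhibits the event as countable operations
on measurable events. -/
lemma rootTotal_eq_coe_iff (a : Vertex → ℕ) (k : ℕ) :
    rootTotal a = k ↔ (∀ n, rootVisits n a ≤ k) ∧ ∃ n, rootVisits n a = k := by
  constructor
  · intro h
    refine ⟨fun n => ?_, ?_⟩
    · have : (rootVisits n a : ℕ∞) ≤ rootTotal a := le_iSup (fun n => (rootVisits n a : ℕ∞)) n
      rw [h] at this
      exact_mod_cast this
    · obtain ⟨n, hn⟩ := ENat.exists_eq_iSup_of_lt_top (f := fun n => (rootVisits n a : ℕ∞))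
        (by change rootTotal a < ⊤; rw [h]; exact ENat.natCast_lt_top k)
      refine ⟨n, ?_⟩
      change _ = rootTotal a at hn
      rw [h] at hn
      exact_mod_cast hn
  · rintro ⟨h, n, hn⟩
    refine le_antisymm (iSup_le fun n => by exact_mod_cast h n) ?_
    rw [← hn]
    exact le_iSup (fun n => (rootVisits n a : ℕ∞)) n

lemma rootTotal_toENNReal (a : Vertex → ℕ) :
    (rootTotal a : ℝ≥0∞) = ⨆ n, (rootVisits n a : ℝ≥0∞) := by
  simp [rootTotal]

/-! ### The branching property of the arrivals -/

@[fun_prop]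
lemma measurable_shift (u : Vertex) : Measurable (shift u) :=
  measurable_pi_lambda _ fun _ => measurable_pi_apply _

@[fun_prop]
lemma measurable_rootVisits (n : ℕ) : Measurable (rootVisits n) := by
  induction n with
  | zero => exact measurable_const
  | succ n ih =>
    have h : ∀ b : Bool, Measurable fun a => rootVisits n (shift [b] a) - 1 := fun b =>
      (measurable_of_countable fun k : ℕ => k - 1).comp (ih.comp (measurable_shift [b]))
    exact ((measurable_pi_apply _).add (h false)).add (h true)

@[fun_prop]
lemma measurable_rootTotal : Measurable rootTotal := by
  rw [ENat.measurable_iff]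
  intro k
  have : rootTotal ⁻¹' {(k : ℕ∞)} = (⋂ n, rootVisits n ⁻¹' {j | j ≤ k}) ∩
      ⋃ n, rootVisits n ⁻¹' {k} := by
    ext a
    simp [rootTotal_eq_coe_iff]
  rw [this]
  exact (MeasurableSet.iInter fun n => measurable_rootVisits n (MeasurableSet.of_discrete)).inter
    (MeasurableSet.iUnion fun n => measurable_rootVisits n (MeasurableSet.of_discrete))

/-- Arrivals given by those on the root and on the subtrees above its children. -/
def glue (p : ℕ × (Vertex → ℕ) × (Vertex → ℕ)) : Vertex → ℕ
  | [] => p.1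
  | false :: u => p.2.1 u
  | true :: u => p.2.2 u

@[fun_prop]
lemma measurable_glue : Measurable glue := by
  refine measurable_pi_lambda _ fun u => ?_
  rcases u with _ | ⟨_ | _, u⟩
  · exact measurable_fst
  · exact (measurable_pi_apply u).comp (measurable_fst.comp measurable_snd)
  · exact (measurable_pi_apply u).comp (measurable_snd.comp measurable_snd)

variable (μ : PMF ℕ)

instance : IsProbabilityMeasure (arrivalLaw μ) := by
  unfold arrivalLaw; infer_instance

lemma map_glue :
    (μ.toMeasure.prod ((arrivalLaw μ).prod (arrivalLaw μ))).map glue = arrivalLaw μ := by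
  classical
  refine Measure.eq_infinitePi _ fun s t ht => ?_
  -- The cylinder is rewritten over a finite set made of the root and of the same set `A` in both
  -- subtrees, with trivial constraints off `s`; its preimage by `glue` is then a product.
  set t' : Vertex → Set ℕ := fun u => if u ∈ s then t u else Set.univ with ht'
  obtain ⟨A, hA⟩ : ∃ A : Finset Vertex, A = s.image List.tail := ⟨_, rfl⟩
  set s' : Finset Vertex := insert [] (A.image (List.cons false) ∪ A.image (List.cons true))
    with hs'
  have hss : s ⊆ s' := by
    intro u hu
    rcases u with _ | ⟨b, u⟩
    · simp [hs']
    · have : u ∈ A := hA ▸ Finset.mem_image.2 ⟨_, hu, rfl⟩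
      cases b <;> simp [hs', this]
  have hpi : Set.pi (s : Set Vertex) t = Set.pi (s' : Set Vertex) t' := by
    ext a
    simp only [Set.mem_pi, Finset.mem_coe]
    refine ⟨fun h u _ => ?_, fun h u hu => ?_⟩
    · simp only [ht']
      split_ifs with hu
      · exact h u hu
      · trivial
    · have := h u (hss hu)
      simpa [ht', hu] using this
  have hprod : ∏ u ∈ s, μ.toMeasure (t u) = ∏ u ∈ s', μ.toMeasure (t' u) := by
    rw [← Finset.prod_subset hss]
    · refine Finset.prod_congr rfl fun u hu => ?_
      simp [ht', hu]
    · intro u _ hu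
      simp [ht', hu]
  have hpre : glue ⁻¹' (Set.pi (s' : Set Vertex) t') = t' [] ×ˢ
      (Set.pi (A : Set Vertex) (fun u => t' (false :: u)) ×ˢ
        Set.pi (A : Set Vertex) (fun u => t' (true :: u))) := by
    ext ⟨k, a, b⟩
    simp only [hs', Set.mem_preimage, Set.mem_pi, Finset.mem_coe, Finset.mem_insert,
      Finset.mem_union, or_imp, forall_and, forall_eq, Finset.forall_mem_image, Set.mem_prod]
    rfl
  have hd : Disjoint (A.image (List.cons false)) (A.image (List.cons true)) := by
    rw [Finset.disjoint_left]
    simp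
  rw [hpi, hprod, Measure.map_apply measurable_glue
    (MeasurableSet.pi (Finset.countable_toSet _) fun u _ => MeasurableSet.of_discrete), hpre,
    Measure.prod_prod, Measure.prod_prod, arrivalLaw,
    Measure.infinitePi_pi _ fun u _ => MeasurableSet.of_discrete,
    Measure.infinitePi_pi _ fun u _ => MeasurableSet.of_discrete, hs',
    Finset.prod_insert (by simp), Finset.prod_union hd, Finset.prod_image (by simp),
    Finset.prod_image (by simp)]

/-- The arrivals on the root and on the subtrees above its children are independent. -/
lemma lintegral_glue {f : (Vertex → ℕ) → ℝ≥0∞} (hf : Measurable f) :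
    ∫⁻ a, f a ∂(arrivalLaw μ)
      = ∑' k, μ k * ∫⁻ a, ∫⁻ b, f (glue (k, a, b)) ∂(arrivalLaw μ) ∂(arrivalLaw μ) := by
  conv_lhs => rw [← map_glue]
  rw [lintegral_map hf measurable_glue, lintegral_prod _ (by fun_prop), lintegral_countable']
  refine tsum_congr fun k => ?_
  rw [PMF.toMeasure_apply_singleton _ _ (MeasurableSet.of_discrete), mul_comm, lintegral_prod]
  have : Measurable fun p => f (glue (k, p)) :=
    hf.comp (measurable_glue.comp (measurable_const.prodMk measurable_id))
  exact this.aemeasurable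

lemma shift_false_glue (k : ℕ) (a b : Vertex → ℕ) : shift [false] (glue (k, a, b)) = a := rfl

lemma shift_true_glue (k : ℕ) (a b : Vertex → ℕ) : shift [true] (glue (k, a, b)) = b := rfl

lemma map_shift (u : Vertex) : (arrivalLaw μ).map (shift u) = arrivalLaw μ := by
  induction u with
  | nil => exact Measure.map_id
  | cons b u ih =>
    have hb : (arrivalLaw μ).map (shift [b]) = arrivalLaw μ := by
      conv_lhs => rw [← map_glue]
      rw [Measure.map_map (measurable_shift _) measurable_glue]
      cases b
      · have : shift [false] ∘ glue = Prod.fst ∘ Prod.snd := rfl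
        rw [this, ← Measure.map_map measurable_fst measurable_snd, Measure.map_snd_prod,
          measure_univ, one_smul, Measure.map_fst_prod, measure_univ, one_smul]
      · have : shift [true] ∘ glue = Prod.snd ∘ Prod.snd := rfl
        rw [this, ← Measure.map_map measurable_snd measurable_snd, Measure.map_snd_prod,
          measure_univ, one_smul, Measure.map_snd_prod, measure_univ, one_smul]
    have : shift (b :: u) = shift u ∘ shift [b] := by
      funext a
      exact (shift_shift [b] u a).symm
    rw [this, ← Measure.map_map (measurable_shift _) (measurable_shift _), hb, ih]

/-! ### Clusters of occupied vertices -/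

/-- The cluster of the root contains no vertex of height `n` or more. -/
def LowCluster : ℕ → (Vertex → ℕ) → Prop
  | 0, a => rootTotal a = 0
  | n + 1, a => rootTotal a = 0 ∨
      (LowCluster n (shift [false] a) ∧ LowCluster n (shift [true] a))

lemma LowCluster.succ {n : ℕ} {a : Vertex → ℕ} (h : LowCluster n a) : LowCluster (n + 1) a := by
  induction n generalizing a with
  | zero => exact Or.inl h
  | succ n ih => exact h.imp id fun h => ⟨ih h.1, ih h.2⟩

lemma LowCluster.mono {n m : ℕ} (hnm : n ≤ m) {a : Vertex → ℕ} (h : LowCluster n a) :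
    LowCluster m a := by
  induction m, hnm using Nat.le_induction with
  | base => exact h
  | succ m _ ih => exact ih.succ

lemma mem_black_iff (a : Vertex → ℕ) (u : Vertex) : u ∈ black a ↔ rootTotal (shift u a) ≠ 0 := by
  rw [black, Set.mem_ofPred_eq, totalVisits_eq_rootTotal, Order.one_le_iff_ne_zero]

lemma mem_of_mem_above {s : Set Vertex} {u w : Vertex} (h : w ∈ above s u) : u ∈ s :=
  h.2 u List.prefix_rfl h.1

lemma prefix_iff_eq_or (u w : Vertex) : u <+: w ↔ w = u ∨ ∃ b : Bool, u ++ [b] <+: w := by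
  constructor
  · rintro ⟨_ | ⟨b, v⟩, rfl⟩
    · simp
    · exact Or.inr ⟨b, v, by simp⟩
  · rintro (rfl | ⟨b, h⟩)
    · exact List.prefix_rfl
    · exact (List.prefix_append _ _).trans h

lemma mem_above_iff {s : Set Vertex} {u w : Vertex} :
    w ∈ above s u ↔ u ∈ s ∧ (w = u ∨ ∃ b : Bool, w ∈ above s (u ++ [b])) := by
  constructor
  · intro h
    refine ⟨mem_of_mem_above h, ((prefix_iff_eq_or u w).1 h.1).imp id ?_⟩
    rintro ⟨b, hb⟩
    exact ⟨b, hb, fun p hp hpw => h.2 p ((List.prefix_append _ _).trans hp) hpw⟩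
  · rintro ⟨hu, rfl | ⟨b, hb⟩⟩
    · refine ⟨List.prefix_rfl, fun p hp hp' => ?_⟩
      rwa [← List.IsPrefix.eq_of_length hp (le_antisymm hp.length_le hp'.length_le)]
    · refine ⟨(List.prefix_append _ _).trans hb.1, fun p hp hpw => ?_⟩
      rcases (prefix_iff_eq_or u p).1 hp with rfl | ⟨c, hc⟩
      · exact hu
      · have := List.prefix_of_prefix_length_le (hc.trans hpw) hb.1 (by simp)
        rw [this.eq_of_length (by simp)] at hc
        exact hb.2 p hc hpw

lemma length_lt_of_lowCluster {a : Vertex → ℕ} {n : ℕ} {u w : Vertex}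
    (h : LowCluster n (shift u a)) (hw : w ∈ above (black a) u) : w.length < u.length + n := by
  induction n generalizing u with
  | zero => exact absurd h ((mem_black_iff a u).1 (mem_of_mem_above hw))
  | succ n ih =>
    obtain ⟨hu, rfl | ⟨b, hb⟩⟩ := mem_above_iff.1 hw
    · omega
    · have h' : LowCluster n (shift (u ++ [b]) a) := by
        have := h.resolve_left ((mem_black_iff a u).1 hu)
        simp only [shift_shift] at this
        cases b
        exacts [this.1, this.2]
      have := ih h' hb
      simp at this
      omega

lemma exists_mem_above_of_not_lowCluster {a : Vertex → ℕ} {n : ℕ} {u : Vertex}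
    (h : ¬ LowCluster n (shift u a)) : ∃ w ∈ above (black a) u, w.length = u.length + n := by
  induction n generalizing u with
  | zero => exact ⟨u, mem_above_iff.2 ⟨(mem_black_iff a u).2 h, Or.inl rfl⟩, rfl⟩
  | succ n ih =>
    simp only [LowCluster, not_or, not_and_or, shift_shift] at h
    obtain ⟨b, hb⟩ : ∃ b : Bool, ¬ LowCluster n (shift (u ++ [b]) a) :=
      h.2.elim (fun h => ⟨_, h⟩) (fun h => ⟨_, h⟩)
    obtain ⟨w, hw, hl⟩ := ih hb
    refine ⟨w, mem_above_iff.2 ⟨(mem_black_iff a u).2 h.1, Or.inr ⟨b, hw⟩⟩, ?_⟩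
    simp at hl
    omega

lemma above_subset (s : Set Vertex) (u : Vertex) : above s u ⊆ s :=
  fun w hw => hw.2 w hw.1 List.prefix_rfl

/-- Otherwise the black vertices joined to the root through black ancestors reach every height, and
they all lie in one component. -/
lemma exists_lowCluster_of_finite {a : Vertex → ℕ}
    (h : ∀ C : (binaryTree.induce (black a)).ConnectedComponent, C.supp.Finite) :
    ∃ n, LowCluster n a := by
  by_contra! hcon
  have hw : ∀ n, ∃ w ∈ above (black a) [], w.length = n := fun n => by
    simpa using exists_mem_above_of_not_lowCluster (u := []) (hcon n)
  obtain ⟨w0, hw0, -⟩ := hw 0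
  have h0 : [] ∈ above (black a) [] := mem_above_iff.2 ⟨mem_of_mem_above hw0, Or.inl rfl⟩
  have hc : (binaryTree.induce (above (black a) [])).Connected :=
    connected_of_append_mem h0 fun u b hu => ⟨List.nil_prefix,
      fun p hp hpu => hu.2 p hp (hpu.trans (List.prefix_append _ _))⟩
  set C := (binaryTree.induce (black a)).connectedComponentMk ⟨[], above_subset _ _ h0⟩ with hC
  obtain ⟨N, hN⟩ := ((h C).image fun v : black a => (v : Vertex).length).bddAbove
  obtain ⟨w, hw, hl⟩ := hw (N + 1)
  have hr : (binaryTree.induce (above (black a) [])).Reachable ⟨w, hw⟩ ⟨[], h0⟩ :=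
    hc.preconnected _ _
  have hr' := hr.map (SimpleGraph.induceHomOfLE binaryTree (above_subset (black a) [])).toHom
  have : (⟨w, above_subset _ _ hw⟩ : black a) ∈ C.supp := by
    rw [SimpleGraph.ConnectedComponent.mem_supp_iff, hC, SimpleGraph.ConnectedComponent.eq]
    exact hr'
  have := hN ⟨_, this, rfl⟩
  simp only at this
  omega

lemma exists_bottom (s : Set Vertex) (v : Vertex) (hv : v ∈ s) :
    ∃ u : Vertex, v ∈ above s u ∧ ∀ (p : Vertex) (b : Bool), u = p ++ [b] → p ∉ s := by
  induction v using List.reverseRecOn with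
  | nil => exact ⟨[], mem_above_iff.2 ⟨hv, Or.inl rfl⟩, fun p b h => by simp at h⟩
  | append_singleton v b ih =>
    by_cases hvs : v ∈ s
    · obtain ⟨u, hu, hp⟩ := ih hvs
      refine ⟨u, ⟨hu.1.trans (List.prefix_append _ _), fun r hur hr => ?_⟩, hp⟩
      rw [List.prefix_concat_iff] at hr
      rcases hr with rfl | hr
      · exact hv
      · exact hu.2 r hur hr
    · refine ⟨v ++ [b], mem_above_iff.2 ⟨hv, Or.inl rfl⟩, fun p c h => ?_⟩
      rwa [← (List.append_inj' h rfl).1]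

/-- Following black ancestors down from a vertex of the component reaches a vertex with no black
parent. The whole component lies above it, at bounded height. -/
lemma finite_of_lowCluster {a : Vertex → ℕ} (h : ∀ u, ∃ n, LowCluster n (shift u a))
    (C : (binaryTree.induce (black a)).ConnectedComponent) : C.supp.Finite := by
  induction C using SimpleGraph.ConnectedComponent.ind with | _ v
  obtain ⟨u, hv, hu⟩ := exists_bottom (black a) v v.2
  obtain ⟨n, hn⟩ := h u
  refine ((List.finite_length_lt Bool (u.length + n)).preimage
    Subtype.val_injective.injOn).subset fun w hw => ?_
  rw [SimpleGraph.ConnectedComponent.mem_supp_iff, SimpleGraph.ConnectedComponent.eq] at hw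
  exact length_lt_of_lowCluster hn (mem_above_of_reachable hu hw.symm hv)

lemma measurableSet_lowCluster (n : ℕ) : MeasurableSet {a | LowCluster n a} := by
  have h0 : MeasurableSet {a | rootTotal a = 0} :=
    measurable_rootTotal (MeasurableSet.of_discrete (s := {0}))
  induction n with
  | zero => exact h0
  | succ n ih =>
    exact h0.union ((measurable_shift [false] ih).inter (measurable_shift [true] ih))

/-! ### The law of the cluster of the root -/

/-- The indicator function of the event that the cluster of the root has a height less than `n`. -/
def lowInd (n : ℕ) : (Vertex → ℕ) → ℝ≥0∞ := {a | LowCluster n a}.indicator 1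

@[fun_prop]
lemma measurable_lowInd (n : ℕ) : Measurable (lowInd n) :=
  measurable_one.indicator (measurableSet_lowCluster n)

open CarTree

/-- The probability that no car visits the root. -/
def emptyProb (μ : PMF ℕ) : ℝ≥0∞ := arrivalLaw μ {a | rootTotal a = 0}

/-- The first term will give the empty tree and the second the trees with an occupied root, for
which the two subtrees are independent. -/
lemma lowInd_succ_mul (n : ℕ) (g : ℕ∞ → ℝ≥0∞) (a : Vertex → ℕ) :
    lowInd (n + 1) a * g (rootTotal a) = {a | rootTotal a = 0}.indicator (fun _ => g 0) a
      + lowInd n (shift [false] a) * (lowInd n (shift [true] a) *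
        (if rootTotal a = 0 then 0 else g (rootTotal a))) := by
  by_cases h : rootTotal a = 0
  · simp [lowInd, Set.indicator, LowCluster, h]
  · by_cases h1 : LowCluster n (shift [false] a) <;> by_cases h2 : LowCluster n (shift [true] a) <;>
      simp [lowInd, Set.indicator, LowCluster, h, h1, h2]

lemma coe_vis_sub_one (t : CarTree) : (t.vis : ℕ∞) - 1 = (t.fl : ℕ∞) := by
  rw [fl]; push_cast; rfl

variable (μ : PMF ℕ)

/-- The cluster of the root is distributed as a fully parked tree, each vertex of its boundary
being empty independently. -/
lemma lintegral_lowInd (n : ℕ) (g : ℕ∞ → ℝ≥0∞) :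
    ∫⁻ a, lowInd n a * g (rootTotal a) ∂(arrivalLaw μ) = emptyProb μ *
      ∑' t : CarTree, if t.height ≤ n then W μ (emptyProb μ) t * g t.vis else 0 := by
  have hms : MeasurableSet {a | rootTotal a = 0} := measurableSet_lowCluster 0
  have hmeas : ∀ g : ℕ∞ → ℝ≥0∞, Measurable g := fun g => measurable_of_countable g
  induction n generalizing g with
  | zero =>
    have : ∀ a, lowInd 0 a * g (rootTotal a)
        = {a | rootTotal a = 0}.indicator (fun _ => g 0) a := by
      intro a
      by_cases h : rootTotal a = 0 <;> simp [lowInd, LowCluster, Set.indicator, h]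
    simp only [this]
    rw [lintegral_indicator_const hms, tsum_eq_single nil]
    · simp [height, W, vis, emptyProb, mul_comm]
    · rintro (_ | ⟨k, l, r⟩) h
      · exact absurd rfl h
      · simp [height]
  | succ n ih =>
    set q := emptyProb μ with hq
    -- Vanishing at 0 matches the vanishing of `W` at trees whose root is not occupied.
    set h : ℕ∞ → ℝ≥0∞ := fun v => if v = 0 then 0 else g v with hh
    have hT : ∀ (k : ℕ) (a b : Vertex → ℕ), rootTotal (glue (k, a, b))
        = k + (rootTotal a - 1) + (rootTotal b - 1) := fun k a b => by
      rw [rootTotal_eq, shift_false_glue, shift_true_glue]; rfl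
    have hm2 : Measurable fun a => lowInd n (shift [false] a) *
        (lowInd n (shift [true] a) * h (rootTotal a)) :=
      ((measurable_lowInd n).comp (measurable_shift _)).mul
        (((measurable_lowInd n).comp (measurable_shift _)).mul
          ((hmeas h).comp measurable_rootTotal))
    simp only [lowInd_succ_mul]
    rw [lintegral_add_right _ hm2, lintegral_indicator_const hms, lintegral_glue μ hm2]
    simp only [shift_false_glue, shift_true_glue, hT]
    have hin : ∀ (k : ℕ) (a : Vertex → ℕ), ∫⁻ b, lowInd n a * (lowInd n b *
        h (k + (rootTotal a - 1) + (rootTotal b - 1))) ∂(arrivalLaw μ) = lowInd n a *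
        (q * ∑' r : CarTree, if r.height ≤ n then
          W μ q r * h (k + (rootTotal a - 1) + (r.vis - 1)) else 0) := by
      intro k a
      rw [lintegral_const_mul, ih fun v => h (k + (rootTotal a - 1) + (v - 1))]
      exact (measurable_lowInd n).mul
        ((hmeas fun v => h (k + (rootTotal a - 1) + (v - 1))).comp measurable_rootTotal)
    simp only [hin]
    have hout := fun k : ℕ => ih fun v => (q * ∑' r : CarTree, if r.height ≤ n then
          W μ q r * h (k + (v - 1) + (r.vis - 1)) else 0)
    simp only [hout]
    -- Each child contributes a factor q: one becomes the factor of the new vertex in `W`, the other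
    -- stays in front of the sum.
    rw [CarTree.tsum_eq, mul_add]
    congr 1
    · simp [height, W, vis, hq, emptyProb, mul_comm]
    · rw [← ENNReal.tsum_mul_left]
      refine tsum_congr fun k => ?_
      simp only [← ENNReal.tsum_mul_left]
      refine tsum_congr fun l => ?_
      by_cases hl : l.height ≤ n
      · simp only [hl, if_true, ← ENNReal.tsum_mul_left]
        refine tsum_congr fun r => ?_
        by_cases hr : r.height ≤ n
        · have hN : (k : ℕ∞) + (l.vis - 1) + (r.vis - 1) = ((k + l.fl + r.fl : ℕ) : ℕ∞) := by
            rw [coe_vis_sub_one, coe_vis_sub_one]; push_cast; rfl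
          have hvis : (node k l r).vis = k + l.fl + r.fl := rfl
          rw [hN, hvis]
          by_cases hz : 1 ≤ k + l.fl + r.fl
          · have hz' : ((k + l.fl + r.fl : ℕ) : ℕ∞) ≠ 0 := by
              exact_mod_cast (Nat.one_le_iff_ne_zero.1 hz)
            simp only [height, hl, hr, W, hz, hh, if_true, if_neg hz', max_le_iff, and_self,
              add_le_add_iff_right]
            ring
          · have hz' : k + l.fl + r.fl = 0 := by omega
            simp [hh, W, hz']
        · simp [hr, height]
      · simp [hl, height]

lemma tsum_eq_iSup_height (w : CarTree → ℝ≥0∞) :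
    ∑' t, w t = ⨆ n : ℕ, ∑' t : CarTree, if t.height ≤ n then w t else 0 := by
  refine le_antisymm ?_ (iSup_le fun n => ENNReal.tsum_le_tsum fun t => ?_)
  · rw [ENNReal.tsum_eq_iSup_sum]
    refine iSup_le fun s => le_iSup_of_le (s.sup height) ?_
    refine le_trans (Finset.sum_le_sum fun t ht => ?_) (ENNReal.sum_le_tsum s)
    rw [if_pos (Finset.le_sup ht)]
  · split_ifs <;> simp

lemma measurableSet_exists_lowCluster : MeasurableSet {a | ∃ n, LowCluster n a} := by
  rw [Set.ofPred_exists]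
  exact MeasurableSet.iUnion measurableSet_lowCluster

lemma lintegral_exists_lowCluster (g : ℕ∞ → ℝ≥0∞) :
    ∫⁻ a, {a | ∃ n, LowCluster n a}.indicator (fun a => g (rootTotal a)) a ∂(arrivalLaw μ)
      = emptyProb μ * ∑' t : CarTree, W μ (emptyProb μ) t * g t.vis := by
  have hmono : Monotone fun n a => lowInd n a * g (rootTotal a) := by
    intro n m hnm a
    by_cases h : LowCluster n a
    · simp [lowInd, h, h.mono hnm]
    · simp [lowInd, h]
  have : ∀ a, {a | ∃ n, LowCluster n a}.indicator (fun a => g (rootTotal a)) a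
      = ⨆ n, lowInd n a * g (rootTotal a) := by
    intro a
    by_cases h : ∃ n, LowCluster n a
    · rw [Set.indicator_of_mem (s := {a | ∃ n, LowCluster n a}) h]
      obtain ⟨n, hn⟩ := h
      refine le_antisymm (le_iSup_of_le n ?_) (iSup_le fun m => ?_)
      · simp [lowInd, hn]
      · refine mul_le_of_le_one_left zero_le ?_
        exact Set.indicator_le_self' (fun _ _ => zero_le) a
    · rw [Set.indicator_of_notMem (s := {a | ∃ n, LowCluster n a}) h]
      rw [eq_comm, ENNReal.iSup_eq_zero]
      intro n
      have hn : ¬ LowCluster n a := fun hn => h ⟨n, hn⟩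
      simp [lowInd, hn]
  simp only [this]
  rw [lintegral_iSup _ hmono]
  · simp only [lintegral_lowInd]
    rw [← ENNReal.mul_iSup, ← tsum_eq_iSup_height]
  · intro n
    exact (measurable_lowInd n).mul ((measurable_of_countable g).comp measurable_rootTotal)

/-! ### From finite clusters to the equation -/

/-- The root is empty when no car arrives there and neither child sends one, that is, each child has
at most one visitor; these three events are independent. -/
lemma emptyProb_eq :
    emptyProb μ = μ 0 * (arrivalLaw μ {a | rootTotal a ≤ 1}) ^ 2 := by
  have hm0 : MeasurableSet {a | rootTotal a = 0} := measurableSet_lowCluster 0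
  have hm1 : MeasurableSet {a | rootTotal a ≤ 1} :=
    measurable_rootTotal (MeasurableSet.of_discrete (s := {v | v ≤ 1}))
  have hT : ∀ (k : ℕ) (a b : Vertex → ℕ),
      {a | rootTotal a = 0}.indicator (1 : (Vertex → ℕ) → ℝ≥0∞) (glue (k, a, b))
        = {a | rootTotal a ≤ 1}.indicator (fun _ => if k = 0 then
          {a | rootTotal a ≤ 1}.indicator (1 : (Vertex → ℕ) → ℝ≥0∞) b else 0) a := by
    intro k a b
    have : rootTotal (glue (k, a, b)) = 0 ↔ rootTotal a ≤ 1 ∧ k = 0 ∧ rootTotal b ≤ 1 := by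
      rw [rootTotal_eq, shift_false_glue, shift_true_glue]
      simp only [add_eq_zero, tsub_eq_zero_iff_le, glue, Nat.cast_eq_zero]
      tauto
    simp only [Set.indicator_apply, Set.mem_ofPred_eq, this]
    by_cases h1 : rootTotal a ≤ 1 <;> by_cases h2 : k = 0 <;> by_cases h3 : rootTotal b ≤ 1 <;>
      simp [h1, h2, h3]
  rw [emptyProb, ← lintegral_indicator_one hm0, lintegral_glue μ (measurable_one.indicator hm0),
    tsum_eq_single 0]
  · have : ∀ a, ∫⁻ b, {a | rootTotal a = 0}.indicator (1 : (Vertex → ℕ) → ℝ≥0∞) (glue (0, a, b))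
        ∂(arrivalLaw μ) = {a | rootTotal a ≤ 1}.indicator
          (fun _ => arrivalLaw μ {a | rootTotal a ≤ 1}) a := by
      intro a
      simp only [hT, if_true]
      by_cases h : rootTotal a ≤ 1
      · simp only [Set.indicator_of_mem (show a ∈ {a | rootTotal a ≤ 1} from h)]
        exact lintegral_indicator_one hm1
      · simp [h]
    simp only [this]
    rw [lintegral_indicator_const hm1, sq]
  · intro k hk
    simp [hT, hk]

lemma exists_of_finite_clusters (h : ∀ᵐ a ∂(arrivalLaw μ), ∃ n, LowCluster n a) :
    emptyProb μ ≠ 0 ∧ emptyProb μ ≠ ∞ ∧ Phi μ (emptyProb μ) 0 ≠ ∞ ∧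
      1 = μ 0 * emptyProb μ * Phi μ (emptyProb μ) 0 ^ 2 := by
  have hg : ∀ g : ℕ∞ → ℝ≥0∞, ∫⁻ a, g (rootTotal a) ∂(arrivalLaw μ)
      = emptyProb μ * ∑' t : CarTree, W μ (emptyProb μ) t * g t.vis := by
    intro g
    rw [← lintegral_exists_lowCluster]
    refine lintegral_congr_ae ?_
    filter_upwards [h] with a ha
    rw [Set.indicator_of_mem (s := {a | ∃ n, LowCluster n a}) ha]
  have hP : arrivalLaw μ {a | rootTotal a ≤ 1} = emptyProb μ * Phi μ (emptyProb μ) 0 := by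
    have hm1 : MeasurableSet {a | rootTotal a ≤ 1} :=
      measurable_rootTotal (MeasurableSet.of_discrete (s := {v | v ≤ 1}))
    have := hg ({v | v ≤ 1}.indicator 1)
    rw [show (fun a => ({v : ℕ∞ | v ≤ 1}.indicator (1 : ℕ∞ → ℝ≥0∞)) (rootTotal a))
      = {a | rootTotal a ≤ 1}.indicator 1 from rfl, lintegral_indicator_one hm1] at this
    rw [this, Phi_zero]
    congr 1
    refine tsum_congr fun t => ?_
    by_cases ht : t.vis ≤ 1
    · have : t.fl = 0 := by simp only [fl]; omega
      simp [this, ht]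
    · have : t.fl ≠ 0 := by simp only [fl]; omega
      simp [this, ht]
  -- With g = 1, q = 0 would give total mass zero.
  have hq0 : emptyProb μ ≠ 0 := by
    intro h0
    have := hg fun _ => 1
    rw [h0] at this
    simp at this
  have hqt : emptyProb μ ≠ ∞ := measure_ne_top _ _
  refine ⟨hq0, hqt, ?_, ?_⟩
  · intro ht
    rw [ht, ENNReal.mul_top hq0] at hP
    exact measure_ne_top _ _ hP
  · have := emptyProb_eq μ
    rw [hP] at this
    refine (ENNReal.mul_right_inj hq0 hqt).1 ?_
    rw [mul_one]
    nth_rewrite 1 [this]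
    ring

/-! ### From the equation to subcriticality -/

variable {μ} {x : ℝ≥0∞}

/-- The visits of the root are stochastically dominated by the stationary law. -/
lemma lintegral_rootVisits_le (h1 : 1 = μ 0 * x * Phi μ x 0 ^ 2) (h0 : Phi μ x 0 ≠ ∞)
    (n : ℕ) {g : ℕ → ℝ≥0∞} (hg : Monotone g) :
    ∫⁻ a, g (rootVisits n a) ∂(arrivalLaw μ) ≤ x * ∑' t : CarTree, W μ x t * g t.vis := by
  induction n generalizing g with
  | zero =>
    simp only [rootVisits, lintegral_const, measure_univ, mul_one]
    calc g 0 = x * Phi μ x 1 * g 0 := by rw [mul_Phi_one h1 h0, one_mul]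
      _ ≤ _ := by
        rw [Phi_one_eq, mul_assoc, ← ENNReal.tsum_mul_right]
        gcongr with t
        exact hg (Nat.zero_le _)
  | succ n ih =>
    have hm : Measurable fun a => g (rootVisits (n + 1) a) :=
      (measurable_of_countable g).comp (measurable_rootVisits _)
    rw [lintegral_glue μ hm, ← tsum_fixed μ x h1]
    simp only [rootVisits, shift_false_glue, shift_true_glue]
    rw [← ENNReal.tsum_mul_left]
    refine ENNReal.tsum_le_tsum fun k => ?_
    calc μ k * ∫⁻ a, ∫⁻ b, g (k + (rootVisits n a - 1) + (rootVisits n b - 1))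
          ∂(arrivalLaw μ) ∂(arrivalLaw μ)
        ≤ μ k * ∫⁻ a, x * ∑' r : CarTree, W μ x r * g (k + (rootVisits n a - 1) + r.fl)
          ∂(arrivalLaw μ) := by
          gcongr with a
          exact ih (g := fun v => g (k + (rootVisits n a - 1) + (v - 1)))
            fun v w hvw => hg (by omega)
      _ ≤ μ k * (x * ∑' l : CarTree, W μ x l *
          (x * ∑' r : CarTree, W μ x r * g (k + l.fl + r.fl))) := by
          gcongr
          refine ih (g := fun v => x * ∑' r : CarTree, W μ x r * g (k + (v - 1) + r.fl)) ?_
          intro v w hvw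
          dsimp only
          gcongr with r
          exact hg (by omega)
      _ = _ := by
          simp only [← ENNReal.tsum_mul_left]
          refine tsum_congr fun l => tsum_congr fun r => ?_
          ring

/-- Domination applied to the indicator of v ≠ 0: the empty tree has stationary mass x, so P(X ≠ 0)
+ x ≤ 1. -/
lemma le_emptyProb (h1 : 1 = μ 0 * x * Phi μ x 0 ^ 2) (h0 : Phi μ x 0 ≠ ∞) :
    x ≤ emptyProb μ := by
  have hm0 : MeasurableSet {a | rootTotal a = 0} := measurableSet_lowCluster 0
  have hc : {a | rootTotal a = 0}ᶜ = ⋃ n, {a | rootVisits n a ≠ 0} := by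
    ext a
    simp [rootTotal]
  have hmono : Monotone fun n => {a | rootVisits n a ≠ 0} := by
    intro n m hnm a ha
    have := rootVisits_mono a hnm
    simp only [Set.mem_ofPred_eq] at ha this ⊢
    omega
  have hle : arrivalLaw μ {a | rootTotal a = 0}ᶜ
      ≤ x * ∑' t : CarTree, W μ x t * (if t.vis = 0 then 0 else 1) := by
    rw [hc, hmono.measure_iUnion]
    refine iSup_le fun n => ?_
    have hmn : MeasurableSet {a | rootVisits n a ≠ 0} :=
      measurable_rootVisits n (MeasurableSet.of_discrete (s := {k | k ≠ 0}))
    rw [← lintegral_indicator_one hmn]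
    refine le_trans (le_of_eq ?_) (lintegral_rootVisits_le h1 h0 n
      (g := fun v => if v = 0 then 0 else 1) fun v w hvw => ?_)
    · refine lintegral_congr fun a => ?_
      by_cases h : rootVisits n a = 0 <;> simp [h]
    · by_cases hv : v = 0
      · simp [hv]
      · have hw : w ≠ 0 := by omega
        simp [hv, hw]
  have hsum : x * ∑' t : CarTree, W μ x t * (if t.vis = 0 then 0 else 1) + x ≤ 1 := by
    refine le_of_le_of_eq ?_ (mul_Phi_one h1 h0)
    rw [Phi_one_eq]
    nth_rewrite 3 [← mul_one x]
    rw [← mul_add]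
    gcongr
    rw [tsum_eq (W μ x), tsum_eq, add_comm]
    gcongr
    · simp [W]
    · rw [show (if nil.vis = 0 then (0 : ℝ≥0∞) else 1) = 0 by simp [vis], mul_zero, zero_add]
      gcongr with k l r
      split_ifs <;> simp
  have htot := prob_add_prob_compl (μ := arrivalLaw μ) hm0
  have : x + arrivalLaw μ {a | rootTotal a = 0}ᶜ
      ≤ emptyProb μ + arrivalLaw μ {a | rootTotal a = 0}ᶜ := by
    rw [emptyProb, htot, add_comm]
    exact le_trans (by gcongr) hsum
  exact (ENNReal.add_le_add_iff_right (measure_ne_top _ _)).1 this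

lemma lintegral_rootTotal_lt_top (h1 : 1 = μ 0 * x * Phi μ x 0 ^ 2) (h0 : Phi μ x 0 ≠ ∞)
    (hx : x ≠ ∞) : ∫⁻ a, (rootTotal a : ℝ≥0∞) ∂(arrivalLaw μ) < ∞ := by
  simp only [rootTotal_toENNReal]
  rw [lintegral_iSup]
  · refine lt_of_le_of_lt (iSup_le fun n => ?_)
      (ENNReal.mul_ne_top hx (tsum_W_mul_vis_ne_top h1 h0)).lt_top
    exact lintegral_rootVisits_le h1 h0 n (g := fun v => (v : ℝ≥0∞))
      fun v w hvw => Nat.cast_le.2 hvw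
  · exact fun n => (measurable_of_countable _).comp (measurable_rootVisits n)
  · exact fun n m hnm a => Nat.cast_le.2 (rootVisits_mono a hnm)

/-- The probability of a finite cluster at the root is qΦ_q(1). It increases with q, is at least
xΦ_x(1) because x ≤ q, and the latter is 1. -/
lemma ae_exists_lowCluster (h1 : 1 = μ 0 * x * Phi μ x 0 ^ 2) (h0 : Phi μ x 0 ≠ ∞) :
    ∀ᵐ a ∂(arrivalLaw μ), ∃ n, LowCluster n a := by
  have h : 1 ≤ arrivalLaw μ {a | ∃ n, LowCluster n a} := by
    rw [← lintegral_indicator_one measurableSet_exists_lowCluster]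
    refine le_of_le_of_eq ?_ (lintegral_exists_lowCluster μ fun _ => 1).symm
    refine le_of_eq_of_le (mul_Phi_one h1 h0).symm ?_
    rw [Phi_one_eq]
    gcongr with t
    · exact le_emptyProb h1 h0
    · rw [mul_one]
      exact W_mono μ (le_emptyProb h1 h0) t
  exact (mem_ae_iff_prob_eq_one measurableSet_exists_lowCluster).2 (le_antisymm prob_le_one h)

lemma subcritical_of_eq (h1 : 1 = μ 0 * x * Phi μ x 0 ^ 2) (h0 : Phi μ x 0 ≠ ∞) (hx : x ≠ ∞) :
    Subcritical μ := by
  constructor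
  · simp only [totalVisits_eq_rootTotal, shift_nil]
    exact lintegral_rootTotal_lt_top h1 h0 hx
  -- There are countably many vertices, and the arrivals above each of them have the law of the
  -- whole.
  · have : ∀ᵐ a ∂(arrivalLaw μ), ∀ u, ∃ n, LowCluster n (shift u a) := by
      rw [ae_all_iff]
      intro u
      refine ae_of_ae_map (p := fun a => ∃ n, LowCluster n a) (measurable_shift u).aemeasurable ?_
      rw [map_shift]
      exact ae_exists_lowCluster h1 h0
    filter_upwards [this] with a ha C
    exact finite_of_lowCluster ha C

end Parking

end

/-! ### The equivalence -/

theorem mainTheorem3 (μ : PMF ℕ) (hμ : μ 0 + μ 1 < 1) :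
    Parking.Subcritical μ ↔
      ∃ x : ℝ≥0, 0 < x ∧ Parking.genF μ x 0 ≠ ∞ ∧
        1 = μ 0 * (x : ℝ≥0∞) * (1 + Parking.genF μ x 0) ^ 2 := by
  constructor
  · rintro ⟨-, h⟩
    obtain ⟨hq0, hqt, hP, h1⟩ := Parking.exists_of_finite_clusters μ
      (h.mono fun a ha => Parking.exists_lowCluster_of_finite ha)
    lift Parking.emptyProb μ to ℝ≥0 using hqt with q
    have hF := Parking.CarTree.one_add_genF μ q 0
    rw [ENNReal.coe_zero] at hF
    refine ⟨q, pos_iff_ne_zero.2 (by exact_mod_cast hq0), ?_, ?_⟩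
    · exact ne_top_of_le_ne_top hP (hF ▸ le_add_self)
    · rw [hF]
      exact h1
  · rintro ⟨x, -, hF, h1⟩
    have hP := Parking.CarTree.one_add_genF μ x 0
    rw [ENNReal.coe_zero] at hP
    rw [hP] at h1
    refine Parking.subcritical_of_eq h1 ?_ ENNReal.coe_ne_top
    rw [← hP]
    exact ENNReal.add_ne_top.2 ⟨ENNReal.one_ne_top, hF⟩
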